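/- Let $\mathcal T=\bigcup_{n\ge 0}\{-1,+1\}^n$ be the infinite binary tree, ordered by extension of sequences. A segment of $\mathcal T$ is a finite linearly ordered subset $\{t_n,t_{n+1},\dots,t_{n+k}\}$ with $t_i\in\{-1,+1\}^i$ for $n\le i\le n+k$. The James tree space $JT$ is the completion of the space of finitely supported functions $x\colon\mathcal T\to\mathbb R$ with respect to the norm $$\|x\|_{JT}=\sup\Big\{\Big[\sum_{i=1}^m\Big|\sum_{t\in S_i}x_t\Big|^2\Big]^{1/2} : S_1,\dots,S_m \text{ are disjoint segments of } \mathcal T\Big\},$$ and $JT^*$ is its dual Banach space. For an infinite-dimensional real Banach space $X$ and $\varepsilon\in[0,1]$ the modulus of asymptotic convexity of $X$ is $$\overline\delta_X(\varepsilon)=\inf_{\|x\|=1}\ \sup_{Y}\ \inf_{y\in Y,\ \|y\|=1}\big[\|x+\varepsilon y\|-1\big],$$ where $Y$ runs over the norm-closed finite-codimensional subspaces of $X$; $X$ is asymptotically uniformly convex if $\overline\delta_X(\varepsilon)>0$ for every $\varepsilon\in(0,1]$. The space $X$ has the Radon–Nikodým property if each nonempty bounded subset of $X$ has nonempty slices of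 arbitrarily small diameter (a slice of $A$ is a set $\{x\in A : f(x)>a\}$ with $f\in X^*$ and $a\in\mathbb R$). Theorem. The dual $JT^*$ of the James tree space is asymptotically uniformly convex: $\overline\delta_{JT^*}(\varepsilon)>0$ for every $\varepsilon\in(0,1]$. Moreover $JT^*$ fails the Radon–Nikodým property, so $JT^*$ is an asymptotically uniformly convex dual space without the Radon–Nikodým property. -/

import Mathlib

/-! ### Finite-codimensional subspaces and asymptotic uniform convexity -/

section Convexity

variable (X : Type*) [NormedAddCommGroup X] [NormedSpace ℝ X]

/-- The closed finite-codimensional subspaces of `X`: the joint kernels of finitely many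
continuous linear functionals on `X`. -/
def finiteCodimSubspaces : Set (Submodule ℝ X) :=
  {Y | ∃ (n : ℕ) (f : Fin n → StrongDual ℝ X),
    Y = ⨅ i, LinearMap.ker (f i : X →ₗ[ℝ] ℝ)}

/-- The modulus of asymptotic convexity
`inf_{x ∈ S(X)} sup_Y inf_{y ∈ S(Y)} (‖x + ε y‖ - 1)`, where `Y` runs over the closed
finite-codimensional subspaces of `X`. It is computed in the complete lattice `EReal`;
when `X` is infinite-dimensional all the index sets are nonempty and the value is real. -/
noncomputable def asymptoticConvexityModulus (ε : ℝ) : EReal :=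
  ⨅ x ∈ {x : X | ‖x‖ = 1}, ⨆ Y ∈ finiteCodimSubspaces X, ⨅ y ∈ {y : X | y ∈ Y ∧ ‖y‖ = 1},
    ((‖x + ε • y‖ - 1 : ℝ) : EReal)

/-- `X` is asymptotically uniformly convex. -/
def IsAsymptoticallyUniformlyConvex : Prop :=
  ∀ ε : ℝ, 0 < ε → ε ≤ 1 → 0 < asymptoticConvexityModulus X ε

/-- The Radon–Nikodým property, in its geometric form: each nonempty bounded subset of `X` has
nonempty slices of arbitrarily small diameter. -/
def HasRadonNikodymProperty : Prop :=
  ∀ A : Set X, A.Nonempty → Bornology.IsBounded A → ∀ ε : ℝ, 0 < ε →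
    ∃ (f : StrongDual ℝ X) (a : ℝ),
      {x ∈ A | a < f x}.Nonempty ∧ Metric.diam {x ∈ A | a < f x} < ε

end Convexity

/-! ### The James tree space -/

namespace JamesTree

/-- The binary tree: a node of level `n` is a sequence of `n` signs (`true` for `+1` and `false`
for `-1`). The tree order is the prefix relation `s <+: t`. -/
abbrev Tree : Type := List Bool

/-- The nodes `t` with `a ≤ t ≤ b` in the tree order. -/
def segment (a b : Tree) : Finset Tree := b.inits.toFinset.filter (fun t => a <+: t)

theorem mem_segment {a b t : Tree} : t ∈ segment a b ↔ a <+: t ∧ t <+: b := by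
  simp [segment, and_comm]

/-- A (finite) segment of the tree: the set `{t_n, …, t_{n+k}}` of all nodes between two
comparable nodes `a = t_n` and `b = t_{n+k}`. -/
def IsSegment (S : Finset Tree) : Prop := ∃ a b : Tree, a <+: b ∧ S = segment a b

/-- The finite families of pairwise disjoint segments. -/
def DisjointSegments : Type :=
  {F : Finset (Finset Tree) //
    (∀ S ∈ F, IsSegment S) ∧ (F : Set (Finset Tree)).PairwiseDisjoint id}

instance : Nonempty DisjointSegments := ⟨⟨∅, by simp, by simp⟩⟩

/-- The space of finitely supported real functions on the tree. -/
def FinSupp : Type := Tree →₀ ℝ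

noncomputable instance : AddCommGroup FinSupp := inferInstanceAs (AddCommGroup (Tree →₀ ℝ))
noncomputable instance : Module ℝ FinSupp := inferInstanceAs (Module ℝ (Tree →₀ ℝ))

/-- The value of a finitely supported function at a node. -/
def FinSupp.coeff (x : FinSupp) (t : Tree) : ℝ := (show Tree →₀ ℝ from x) t

/-- The quantity `(∑_{S ∈ F} |∑_{t ∈ S} x_t|²)^{1/2}`. -/
noncomputable def familyNorm (F : DisjointSegments) (x : FinSupp) : ℝ :=
  Real.sqrt (∑ S ∈ F.1, |∑ t ∈ S, x.coeff t| ^ 2)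

/-- The James tree norm: the supremum of `familyNorm F x` over all finite families `F` of disjoint
segments (a bounded set of reals, see `bddAbove_familyNorm`). -/
noncomputable instance : Norm FinSupp := ⟨fun x => ⨆ F : DisjointSegments, familyNorm F x⟩

theorem norm_def (x : FinSupp) : ‖x‖ = ⨆ F : DisjointSegments, familyNorm F x := rfl

theorem FinSupp.coeff_add (x y : FinSupp) (t : Tree) :
    (x + y).coeff t = x.coeff t + y.coeff t := rfl

theorem FinSupp.coeff_smul (c : ℝ) (x : FinSupp) (t : Tree) :
    (c • x).coeff t = c * x.coeff t := rfl

theorem familyNorm_nonneg (F : DisjointSegments) (x : FinSupp) : 0 ≤ familyNorm F x :=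
  Real.sqrt_nonneg _

theorem bddAbove_familyNorm (x : FinSupp) :
    BddAbove (Set.range fun F : DisjointSegments => familyNorm F x) := by
  classical
  let s : Finset Tree := (show Tree →₀ ℝ from x).support
  refine ⟨∑ t ∈ s, |x.coeff t|, ?_⟩
  rintro _ ⟨F, rfl⟩
  have h0 : ∀ t, t ∉ s → x.coeff t = 0 := fun t ht => Finsupp.notMem_support_iff.mp ht
  have h1 : ∑ S ∈ F.1, |∑ t ∈ S, x.coeff t| ≤ ∑ t ∈ s, |x.coeff t| := by
    calc ∑ S ∈ F.1, |∑ t ∈ S, x.coeff t|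
        ≤ ∑ S ∈ F.1, ∑ t ∈ S, |x.coeff t| :=
          Finset.sum_le_sum fun S _ => Finset.abs_sum_le_sum_abs _ _
      _ = ∑ t ∈ F.1.biUnion id, |x.coeff t| := (Finset.sum_biUnion F.2.2).symm
      _ ≤ ∑ t ∈ F.1.biUnion id ∪ s, |x.coeff t| :=
          Finset.sum_le_sum_of_subset_of_nonneg Finset.subset_union_left
            fun _ _ _ => abs_nonneg _
      _ = ∑ t ∈ s, |x.coeff t| :=
          (Finset.sum_subset Finset.subset_union_right
            fun t _ ht => by rw [h0 t ht, abs_zero]).symm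
  refine le_trans (Real.sqrt_le_iff.mpr ⟨Finset.sum_nonneg fun _ _ => abs_nonneg _, ?_⟩) h1
  exact Finset.sum_sq_le_sq_sum_of_nonneg fun _ _ => abs_nonneg _

theorem familyNorm_le_norm (F : DisjointSegments) (x : FinSupp) : familyNorm F x ≤ ‖x‖ :=
  le_ciSup (bddAbove_familyNorm x) F

theorem familyNorm_add_le (F : DisjointSegments) (x y : FinSupp) :
    familyNorm F (x + y) ≤ familyNorm F x + familyNorm F y := by
  have h := Real.Lp_add_le F.1 (fun S => ∑ t ∈ S, x.coeff t) (fun S => ∑ t ∈ S, y.coeff t)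
    (p := 2) (by norm_num)
  simpa [familyNorm, Real.sqrt_eq_rpow, FinSupp.coeff_add, Finset.sum_add_distrib] using h

theorem familyNorm_smul (F : DisjointSegments) (c : ℝ) (x : FinSupp) :
    familyNorm F (c • x) = |c| * familyNorm F x := by
  simp only [familyNorm, FinSupp.coeff_smul, ← Finset.mul_sum, abs_mul, mul_pow]
  rw [Real.sqrt_mul (by positivity), Real.sqrt_sq (abs_nonneg c)]

theorem abs_coeff_le_norm (x : FinSupp) (t : Tree) : |x.coeff t| ≤ ‖x‖ := by
  have hs : segment t t = {t} := by
    ext u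
    rw [mem_segment, Finset.mem_singleton]
    refine ⟨fun h => h.2.eq_of_length_le h.1.length_le, ?_⟩
    rintro rfl
    exact ⟨List.prefix_rfl, List.prefix_rfl⟩
  let F : DisjointSegments :=
    ⟨{segment t t}, by simpa using ⟨t, t, List.prefix_rfl, rfl⟩, by simp⟩
  refine le_trans (le_of_eq ?_) (familyNorm_le_norm F x)
  simp [familyNorm, F, hs, Real.sqrt_sq_eq_abs]

theorem normedSpaceCore : NormedSpace.Core ℝ FinSupp where
  norm_nonneg x := Real.iSup_nonneg fun F => familyNorm_nonneg F x
  norm_smul c x := by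
    simp only [norm_def, familyNorm_smul, Real.norm_eq_abs]
    exact (Real.mul_iSup_of_nonneg (abs_nonneg c) _).symm
  norm_triangle x y := ciSup_le fun F => (familyNorm_add_le F x y).trans
    (add_le_add (familyNorm_le_norm F x) (familyNorm_le_norm F y))
  norm_eq_zero_iff x := by
    constructor
    · intro h
      refine Finsupp.ext fun t => ?_
      exact abs_nonpos_iff.mp (h ▸ abs_coeff_le_norm x t)
    · rintro rfl
      have h : ∀ t, FinSupp.coeff 0 t = 0 := fun _ => rfl
      simp [norm_def, familyNorm, h]

noncomputable instance : NormedAddCommGroup FinSupp := NormedAddCommGroup.ofCore normedSpaceCore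
noncomputable instance : NormedSpace ℝ FinSupp := NormedSpace.ofCore normedSpaceCore

end JamesTree

/-- The James tree space `JT`: the completion of the finitely supported functions on the binary
tree with respect to the James tree norm. -/
abbrev JamesTreeSpace : Type := UniformSpace.Completion JamesTree.FinSupp

/-!
Write `JT` for the James tree space. For the asymptotic uniform convexity of `JT*`, let `‖x‖ = 1`
in `JT*` and let `u` be a finitely supported function, of norm at most one, with `x u` close
to `1`. For `y` of norm one in a suitable finite-codimensional subspace, a function `v` is found
such that `y v` is bounded below, `x v` is negligible, `y u = 0`, and
`‖u + α v‖² ≤ ‖u‖² + 56 α²`. Evaluating `x + ε y` at `u + α v`, with `α` a small multiple of `ε`,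
gives `‖x + ε y‖ ≥ 1 + c ε²`, with an absolute constant `c > 0`.

That `x v` can be made negligible rests on a form of the Lindenstrauss–Stegall description of `JT*`
(`exists_branches_bound`): for each `η > 0` there are finitely many branches and a level such that
`|x w| ≤ η ‖w‖` for all `w` supported above this level with zero sums over these branches. Away
from finitely many branches the restrictions of `x` to the subtrees at a high level are uniformly
small (`exists_branches_coneNorm_le`), so that, were they not small in the `ℓ²` sense, there would
be flat functions, with small sums over all paths, on which `x` is large; but flat functions can be
added up with an upper `ℓ²` estimate (`exists_flat_bound`). Along a single branch, the same kind of
estimate holds for successive functions with zero sums over the branch (`exists_node_bound`).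

The subspace consists of the `y` that vanish on the unit vectors up to some level `N` and are
annihilated by a weak-star cluster point, in the bidual, of the unit vectors along each of the
chosen branches. Such a `y` is large on some function supported above level `N`, and does not
notice two corrections of it: at the nodes of level `N`, and far up on the chosen branches
(`exists_correction`). These make the sums over the branches vanish, and give the sums over all
paths from a node `τ` of level `N` a prescribed sign. The sign is chosen opposite to the one that
the sums of `u` over the segments ending at `τ` essentially have (`exists_sign`), and then `v`
disturbs the norm of `u` only to second order (`norm_add_sq_le`).

The Radon–Nikodým property fails because the averages of the branch sums over all branches through
a node `t` form a bounded dyadic tree in `JT*`: each member is the midpoint of its two successors,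
which are at distance at least one, so that no nonempty slice of
this set has diameter less than `1 / 2`.
-/

namespace JamesTree

open Finset

/-! ### Linear maps on finitely supported functions -/

theorem FinSupp.ext_coeff {x y : FinSupp} (h : ∀ t, x.coeff t = y.coeff t) : x = y :=
  Finsupp.ext h

/-- The support of a finitely supported function. -/
def FinSupp.supp (x : FinSupp) : Finset Tree := (show Tree →₀ ℝ from x).support

theorem FinSupp.mem_supp {x : FinSupp} {t : Tree} : t ∈ x.supp ↔ x.coeff t ≠ 0 :=
  Finsupp.mem_support_iff

/-- The function taking the value `c` at `t` and `0` elsewhere. -/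
noncomputable def FinSupp.single (t : Tree) (c : ℝ) : FinSupp := Finsupp.single t c

open Classical in
theorem FinSupp.coeff_single (t : Tree) (c : ℝ) (s : Tree) :
    (FinSupp.single t c).coeff s = if t = s then c else 0 :=
  Finsupp.single_apply

/-- The linear functional `x ↦ ∑ t, x t * c t`. -/
noncomputable def weightedSum (c : Tree → ℝ) : FinSupp →ₗ[ℝ] ℝ := Finsupp.linearCombination ℝ c

theorem weightedSum_apply (c : Tree → ℝ) (x : FinSupp) :
    weightedSum c x = ∑ t ∈ x.supp, x.coeff t * c t :=
  Finsupp.linearCombination_apply ℝ x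

theorem weightedSum_eq_sum (c : Tree → ℝ) (x : FinSupp) {s : Finset Tree}
    (h : ∀ t, x.coeff t ≠ 0 → t ∈ s) : weightedSum c x = ∑ t ∈ s, x.coeff t * c t := by
  rw [weightedSum_apply]
  refine sum_subset (fun t ht => h t (FinSupp.mem_supp.1 ht)) fun t _ ht => ?_
  rw [not_not.1 (fun h => ht (FinSupp.mem_supp.2 h)), zero_mul]

theorem weightedSum_congr {c d : Tree → ℝ} {x : FinSupp}
    (h : ∀ t, x.coeff t ≠ 0 → c t = d t) : weightedSum c x = weightedSum d x := by
  rw [weightedSum_apply, weightedSum_apply]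
  exact sum_congr rfl fun t ht => by rw [h t (FinSupp.mem_supp.1 ht)]

theorem weightedSum_single (c : Tree → ℝ) (t : Tree) (a : ℝ) :
    weightedSum c (FinSupp.single t a) = a * c t :=
  Finsupp.linearCombination_single ℝ a t

/-- The evaluation at a node, as a linear map. -/
noncomputable def coeffMap (t : Tree) : FinSupp →ₗ[ℝ] ℝ where
  toFun x := x.coeff t
  map_add' _ _ := rfl
  map_smul' _ _ := rfl

theorem coeff_sum {ι : Type*} (I : Finset ι) (w : ι → FinSupp) (t : Tree) :
    (∑ i ∈ I, w i).coeff t = ∑ i ∈ I, (w i).coeff t :=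
  map_sum (coeffMap t) w I

open Classical in
/-- The function which agrees with `x` on `P` and vanishes off `P`. -/
noncomputable def restrict (P : Set Tree) : FinSupp →ₗ[ℝ] FinSupp where
  toFun x := Finsupp.filter (· ∈ P) (show Tree →₀ ℝ from x)
  map_add' _ _ := Finsupp.filter_add
  map_smul' _ _ := Finsupp.filter_smul

open Classical in
theorem coeff_restrict (P : Set Tree) (x : FinSupp) (t : Tree) :
    (restrict P x).coeff t = if t ∈ P then x.coeff t else 0 :=
  Finsupp.filter_apply _ _ _

theorem coeff_restrict_of_mem {P : Set Tree} {t : Tree} (x : FinSupp) (h : t ∈ P) :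
    (restrict P x).coeff t = x.coeff t := by rw [coeff_restrict, if_pos h]

theorem mem_of_coeff_restrict_ne {P : Set Tree} {x : FinSupp} {t : Tree}
    (h : (restrict P x).coeff t ≠ 0) : t ∈ P := by
  rw [coeff_restrict] at h
  by_contra h'
  exact h (if_neg h')

theorem coeff_ne_of_coeff_restrict_ne {P : Set Tree} {x : FinSupp} {t : Tree}
    (h : (restrict P x).coeff t ≠ 0) : x.coeff t ≠ 0 := by
  rwa [coeff_restrict_of_mem x (mem_of_coeff_restrict_ne h)] at h

theorem restrict_eq_self {P : Set Tree} {x : FinSupp} (h : ∀ t, x.coeff t ≠ 0 → t ∈ P) :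
    restrict P x = x := by
  refine FinSupp.ext_coeff fun t => ?_
  rw [coeff_restrict]
  split_ifs with ht
  · rfl
  · exact (not_not.1 fun h' => ht (h t h')).symm

/-- The sum of the values of a finitely supported function over a (possibly infinite) set of
nodes. -/
noncomputable def pathSum (P : Set Tree) : FinSupp →ₗ[ℝ] ℝ := weightedSum (P.indicator 1)

theorem pathSum_congr {P Q : Set Tree} {x : FinSupp}
    (h : ∀ t, x.coeff t ≠ 0 → (t ∈ P ↔ t ∈ Q)) : pathSum P x = pathSum Q x := by
  classical
  refine weightedSum_congr fun t ht => ?_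
  simp only [Set.indicator_apply, h t ht]

theorem pathSum_coe (S : Finset Tree) (x : FinSupp) : pathSum S x = ∑ t ∈ S, x.coeff t := by
  classical
  rw [pathSum, weightedSum_eq_sum _ _ (s := S ∪ x.supp)
    fun t ht => mem_union_right _ (FinSupp.mem_supp.2 ht)]
  simp only [Set.indicator_apply, mem_coe, Pi.one_apply, mul_ite, mul_one, mul_zero]
  rw [← sum_filter]
  refine sum_congr ?_ fun _ _ => rfl
  ext t
  simp +contextual

theorem pathSum_restrict (P Q : Set Tree) (x : FinSupp) :
    pathSum P (restrict Q x) = pathSum (P ∩ Q) x := by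
  classical
  rw [pathSum, pathSum, weightedSum_eq_sum _ (restrict Q x) (s := x.supp)
    fun t ht => FinSupp.mem_supp.2 (coeff_ne_of_coeff_restrict_ne ht), weightedSum_apply]
  refine sum_congr rfl fun t _ => ?_
  by_cases h1 : t ∈ P <;> by_cases h2 : t ∈ Q <;> simp [coeff_restrict, h1, h2]

theorem pathSum_eq_zero {P : Set Tree} {x : FinSupp} (h : ∀ t, x.coeff t ≠ 0 → t ∉ P) :
    pathSum P x = 0 := by
  rw [pathSum, weightedSum_apply]
  refine sum_eq_zero fun t ht => ?_
  rw [Set.indicator_of_notMem (h t (FinSupp.mem_supp.1 ht)), mul_zero]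

theorem exists_mem_of_pathSum_ne {P : Set Tree} {x : FinSupp} (h : pathSum P x ≠ 0) :
    ∃ t ∈ P, x.coeff t ≠ 0 := by
  by_contra! h'
  exact h (pathSum_eq_zero fun t ht hP => ht (h' t hP))

theorem pathSum_single_of_mem {P : Set Tree} {t : Tree} (a : ℝ) (h : t ∈ P) :
    pathSum P (FinSupp.single t a) = a := by
  rw [pathSum, weightedSum_single, Set.indicator_of_mem h, Pi.one_apply, mul_one]

theorem pathSum_single_of_notMem {P : Set Tree} {t : Tree} (a : ℝ) (h : t ∉ P) :
    pathSum P (FinSupp.single t a) = 0 := by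
  rw [pathSum, weightedSum_single, Set.indicator_of_notMem h, mul_zero]

theorem pathSum_union {P Q : Set Tree} (h : Disjoint P Q) (x : FinSupp) :
    pathSum (P ∪ Q) x = pathSum P x + pathSum Q x := by
  simp only [pathSum, weightedSum_apply, ← sum_add_distrib, ← mul_add]
  refine sum_congr rfl fun t _ => ?_
  rw [Set.indicator_union_of_disjoint h]

/-! ### Paths in the tree -/

/-- Two nodes are comparable in the tree order. -/
def Comparable (s t : Tree) : Prop := s <+: t ∨ t <+: s

/-- A set of nodes containing everything that lies between two of its members. -/
def OrdConvex (Q : Set Tree) : Prop :=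
  ∀ ⦃r s t : Tree⦄, r ∈ Q → t ∈ Q → r <+: s → s <+: t → s ∈ Q

/-- A path: a linearly ordered order-convex set of nodes. The nonempty finite paths are the
segments; allowing the empty set and infinite sets makes paths stable under intersection with
order-convex sets, and includes the branches. -/
def IsPath (P : Set Tree) : Prop :=
  (∀ ⦃s t : Tree⦄, s ∈ P → t ∈ P → Comparable s t) ∧ OrdConvex P

theorem IsPath.inter {P Q : Set Tree} (hP : IsPath P) (hQ : OrdConvex Q) : IsPath (P ∩ Q) :=
  ⟨fun _ _ hs ht => hP.1 hs.1 ht.1,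
    fun _ _ _ hr ht h1 h2 => ⟨hP.2 hr.1 ht.1 h1 h2, hQ hr.2 ht.2 h1 h2⟩⟩

theorem isPath_segment (a b : Tree) : IsPath (segment a b : Set Tree) := by
  refine ⟨fun s t hs ht => ?_, fun r s t hr ht h1 h2 => ?_⟩
  · rw [mem_coe, mem_segment] at hs ht
    exact List.prefix_or_prefix_of_prefix hs.2 ht.2
  · rw [mem_coe, mem_segment] at *
    exact ⟨hr.1.trans h1, h2.trans ht.2⟩

theorem IsSegment.isPath {S : Finset Tree} (hS : IsSegment S) : IsPath (S : Set Tree) := by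
  obtain ⟨a, b, -, rfl⟩ := hS
  exact isPath_segment a b

theorem IsPath.prefix_of_length_le {P : Set Tree} (hP : IsPath P) {s t : Tree} (hs : s ∈ P)
    (ht : t ∈ P) (h : s.length ≤ t.length) : s <+: t := by
  rcases hP.1 hs ht with h' | h'
  · exact h'
  · rw [h'.eq_of_length_le h]

theorem IsPath.isSegment {S : Finset Tree} (hS : IsPath (S : Set Tree)) (hne : S.Nonempty) :
    IsSegment S := by
  obtain ⟨a, ha, hmin⟩ := exists_min_image S List.length hne
  obtain ⟨b, hb, hmax⟩ := exists_max_image S List.length hne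
  refine ⟨a, b, hS.prefix_of_length_le ha hb (hmin b hb), ?_⟩
  ext t
  rw [mem_segment]
  exact ⟨fun ht => ⟨hS.prefix_of_length_le ha ht (hmin t ht),
    hS.prefix_of_length_le ht hb (hmax t ht)⟩, fun h => hS.2 ha hb h.1 h.2⟩

/-- The nodes above `t`. -/
def cone (t : Tree) : Set Tree := {s | t <+: s}

/-- The nodes of level at least `N`. -/
def levelsFrom (N : ℕ) : Set Tree := {s | N ≤ s.length}

/-- The nodes of level `N`. -/
noncomputable def level (N : ℕ) : Finset Tree := (List.finite_length_eq Bool N).toFinset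

theorem mem_level {N : ℕ} {t : Tree} : t ∈ level N ↔ t.length = N := by simp [level]

theorem ordConvex_cone (t : Tree) : OrdConvex (cone t) := fun _ _ _ hr _ h1 _ =>
  List.IsPrefix.trans hr h1

theorem ordConvex_levelsFrom (N : ℕ) : OrdConvex (levelsFrom N) := fun _ _ _ hr _ h1 _ =>
  le_trans hr h1.length_le

theorem comparable_of_mem_cone {s t r : Tree} (hs : r ∈ cone s) (ht : r ∈ cone t) :
    Comparable s t := List.prefix_or_prefix_of_prefix hs ht

theorem eq_of_mem_cone {s t r : Tree} (h : s.length = t.length) (hs : r ∈ cone s)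
    (ht : r ∈ cone t) : s = t := by
  rcases comparable_of_mem_cone hs ht with h' | h'
  · exact h'.eq_of_length h
  · exact (h'.eq_of_length h.symm).symm

/-- A finite set of pairwise incomparable nodes. -/
def IsAntichainNodes (A : Finset Tree) : Prop :=
  ∀ ⦃s⦄, s ∈ A → ∀ ⦃t⦄, t ∈ A → Comparable s t → s = t

theorem isAntichainNodes_of_subset_level {A : Finset Tree} {N : ℕ} (hA : A ⊆ level N) :
    IsAntichainNodes A := by
  intro s hs t ht h
  have h1 := mem_level.1 (hA hs)
  have h2 := mem_level.1 (hA ht)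
  rcases h with h | h
  · exact h.eq_of_length (h1.trans h2.symm)
  · exact (h.eq_of_length (h2.trans h1.symm)).symm

theorem sum_restrict_cone {N : ℕ} {w : FinSupp} (hw : ∀ t, w.coeff t ≠ 0 → N ≤ t.length) :
    ∑ t ∈ level N, restrict (cone t) w = w := by
  classical
  refine FinSupp.ext_coeff fun s => ?_
  rw [coeff_sum]
  by_cases hs : w.coeff s = 0
  · rw [hs]
    refine sum_eq_zero fun t _ => ?_
    rw [coeff_restrict, hs, ite_self]
  · have hl : (s.take N).length = N := by
      rw [List.length_take]; exact min_eq_left (hw s hs)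
    rw [sum_eq_single_of_mem (s.take N) (mem_level.2 hl), coeff_restrict_of_mem]
    · exact List.take_prefix N s
    · intro t ht hne
      rw [coeff_restrict, if_neg]
      intro h
      exact hne (eq_of_mem_cone ((mem_level.1 ht).trans hl.symm) h (List.take_prefix N s))

theorem exists_length_lt (w : FinSupp) : ∃ M : ℕ, ∀ t, w.coeff t ≠ 0 → t.length < M := by
  refine ⟨w.supp.sup List.length + 1, fun t ht => Nat.lt_succ_of_le ?_⟩
  exact le_sup (f := List.length) (FinSupp.mem_supp.2 ht)

/-! ### Estimates for the James tree norm -/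

/-- The defining estimate of the James tree norm, for paths instead of segments. -/
theorem sum_sq_pathSum_le {ι : Type*} (I : Finset ι) (P : ι → Set Tree)
    (hP : ∀ i ∈ I, IsPath (P i)) (hd : (I : Set ι).PairwiseDisjoint P) (w : FinSupp) :
    ∑ i ∈ I, pathSum (P i) w ^ 2 ≤ ‖w‖ ^ 2 := by
  classical
  obtain ⟨M, hM⟩ := exists_length_lt w
  let T : Finset Tree := (List.finite_length_lt Bool M).toFinset
  have hT : ∀ t, t ∈ T ↔ t.length < M := fun t => by simp [T]
  let S : ι → Finset Tree := fun i => T.filter (· ∈ P i)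
  have hmS : ∀ i t, t ∈ S i ↔ t.length < M ∧ t ∈ P i := fun i t => by simp [S, hT]
  have hsum : ∀ i, pathSum (P i) w = ∑ t ∈ S i, w.coeff t := by
    intro i
    rw [← pathSum_coe]
    exact pathSum_congr fun t ht => by rw [mem_coe, hmS]; simp [hM t ht]
  have hSP : ∀ i ∈ I, IsPath (S i : Set Tree) := by
    intro i hi
    refine ⟨fun s t hs ht => (hP i hi).1 ((hmS _ _).1 hs).2 ((hmS _ _).1 ht).2, ?_⟩
    intro r s t hr ht h1 h2
    have hr' := (hmS _ _).1 hr
    have ht' := (hmS _ _).1 ht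
    exact (hmS _ _).2 ⟨h2.length_le.trans_lt ht'.1, (hP i hi).2 hr'.2 ht'.2 h1 h2⟩
  have hSd : ∀ i ∈ I, ∀ j ∈ I, i ≠ j → Disjoint (S i) (S j) := by
    intro i hi j hj hij
    rw [Finset.disjoint_left]
    intro t h1 h2
    exact Set.disjoint_left.1 (hd hi hj hij) ((hmS _ _).1 h1).2 ((hmS _ _).1 h2).2
  let J := I.filter fun i => (S i).Nonempty
  have hJ : ∀ i, i ∈ J ↔ i ∈ I ∧ (S i).Nonempty := fun i => by simp [J]
  let F : DisjointSegments := ⟨J.image S, by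
    refine ⟨fun A hA => ?_, fun A hA B hB hAB => ?_⟩
    · obtain ⟨i, hi, rfl⟩ := mem_image.1 hA
      exact (hSP i ((hJ i).1 hi).1).isSegment ((hJ i).1 hi).2
    · obtain ⟨i, hi, rfl⟩ := mem_image.1 (mem_coe.1 hA)
      obtain ⟨j, hj, rfl⟩ := mem_image.1 (mem_coe.1 hB)
      exact hSd i ((hJ i).1 hi).1 j ((hJ j).1 hj).1 fun h => hAB (by rw [h])⟩
  have hinj : Set.InjOn S J := by
    intro i hi j hj hij
    by_contra hne
    have h := hSd i ((hJ i).1 hi).1 j ((hJ j).1 hj).1 hne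
    rw [← hij, disjoint_self_iff_empty] at h
    exact ((hJ i).1 hi).2.ne_empty h
  have h1 : familyNorm F w ^ 2 ≤ ‖w‖ ^ 2 :=
    pow_le_pow_left₀ (familyNorm_nonneg F w) (familyNorm_le_norm F w) 2
  refine le_trans (le_of_eq ?_) h1
  rw [familyNorm, Real.sq_sqrt (sum_nonneg fun _ _ => by positivity)]
  change _ = ∑ S ∈ J.image S, _
  rw [sum_image hinj, sum_filter_of_ne (p := fun i => (S i).Nonempty)]
  · exact sum_congr rfl fun i _ => by rw [hsum, sq_abs]
  · intro i _ h
    by_contra hne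
    rw [not_nonempty_iff_eq_empty.1 hne] at h
    simp at h

theorem abs_pathSum_le {P : Set Tree} (hP : IsPath P) (w : FinSupp) : |pathSum P w| ≤ ‖w‖ := by
  have h := sum_sq_pathSum_le ({()} : Finset Unit) (fun _ => P) (fun _ _ => hP) (by simp) w
  rw [sum_singleton] at h
  exact abs_le_of_sq_le_sq h (norm_nonneg w)

theorem norm_sq_le {w : FinSupp} {K : ℝ}
    (h : ∀ F : DisjointSegments, ∑ S ∈ F.1, pathSum (S : Set Tree) w ^ 2 ≤ K) : ‖w‖ ^ 2 ≤ K := by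
  have hK : 0 ≤ K := (sum_nonneg fun _ _ => sq_nonneg _).trans (h (Classical.arbitrary _))
  have h1 : ‖w‖ ≤ Real.sqrt K := by
    refine ciSup_le fun F => Real.sqrt_le_sqrt (le_trans (le_of_eq ?_) (h F))
    exact sum_congr rfl fun S _ => by rw [pathSum_coe, sq_abs]
  calc ‖w‖ ^ 2 ≤ Real.sqrt K ^ 2 := pow_le_pow_left₀ (norm_nonneg w) h1 2
    _ = K := Real.sq_sqrt hK

theorem DisjointSegments.pairwiseDisjoint (F : DisjointSegments) :
    (F.1 : Set (Finset Tree)).PairwiseDisjoint fun S => (S : Set Tree) := fun _ hA _ hB hAB =>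
  Finset.disjoint_coe.2 (F.2.2 hA hB hAB)

theorem DisjointSegments.isPath (F : DisjointSegments) {S : Finset Tree} (hS : S ∈ F.1) :
    IsPath (S : Set Tree) := (F.2.1 S hS).isPath

theorem DisjointSegments.sum_sq_le (F : DisjointSegments) (w : FinSupp) :
    ∑ S ∈ F.1, pathSum (S : Set Tree) w ^ 2 ≤ ‖w‖ ^ 2 :=
  sum_sq_pathSum_le F.1 _ (fun _ hS => F.isPath hS) F.pairwiseDisjoint w

/-- Up to a factor the James tree norm is attained. -/
theorem exists_norm_sq_le (w : FinSupp) :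
    ∃ F : DisjointSegments, ‖w‖ ^ 2 ≤ 2 * ∑ S ∈ F.1, pathSum (S : Set Tree) w ^ 2 := by
  by_contra! h
  have h1 : ‖w‖ ^ 2 ≤ ‖w‖ ^ 2 / 2 := norm_sq_le fun F => by linarith [h F]
  have h2 := h (Classical.arbitrary _)
  have h3 : 0 ≤ ∑ S ∈ (Classical.arbitrary DisjointSegments).1, pathSum (S : Set Tree) w ^ 2 :=
    sum_nonneg fun _ _ => sq_nonneg _
  linarith

theorem norm_restrict_le {Q : Set Tree} (hQ : OrdConvex Q) (w : FinSupp) :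
    ‖restrict Q w‖ ≤ ‖w‖ := by
  refine (sq_le_sq₀ (norm_nonneg _) (norm_nonneg w)).1 ?_
  refine norm_sq_le fun F => ?_
  simp only [pathSum_restrict]
  refine sum_sq_pathSum_le F.1 (fun S => (S : Set Tree) ∩ Q) (fun S hS => (F.isPath hS).inter hQ)
    (fun A hA B hB hAB => ?_) w
  exact (F.pairwiseDisjoint hA hB hAB).mono Set.inter_subset_left Set.inter_subset_left

theorem norm_single_le (t : Tree) (c : ℝ) : ‖FinSupp.single t c‖ ≤ |c| := by
  classical
  refine (sq_le_sq₀ (norm_nonneg _) (abs_nonneg c)).1 ?_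
  refine norm_sq_le fun F => ?_
  rw [sq_abs]
  by_cases h : ∃ S ∈ F.1, t ∈ S
  · obtain ⟨S, hS, ht⟩ := h
    rw [sum_eq_single_of_mem S hS, pathSum_single_of_mem c (mem_coe.2 ht)]
    intro S' hS' hne
    rw [pathSum_single_of_notMem, zero_pow two_ne_zero]
    exact fun h' => Set.disjoint_left.1 (F.pairwiseDisjoint hS' hS hne) h' ht
  · push Not at h
    rw [sum_eq_zero fun S hS => ?_]
    · positivity
    · rw [pathSum_single_of_notMem c (fun h' => h S hS h'), zero_pow two_ne_zero]

/-- If every segment has a nonzero sum on at most `K` of the functions `w i`, then these functions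
satisfy an upper `ℓ²` estimate. -/
theorem norm_sum_sq_le {ι : Type*} (I : Finset ι) (w : ι → FinSupp) (K : ℕ)
    (h : ∀ S : Set Tree, IsPath S → ∀ J ⊆ I, (∀ i ∈ J, pathSum S (w i) ≠ 0) → #J ≤ K) :
    ‖∑ i ∈ I, w i‖ ^ 2 ≤ K * ∑ i ∈ I, ‖w i‖ ^ 2 := by
  classical
  refine norm_sq_le fun F => ?_
  calc ∑ S ∈ F.1, pathSum (S : Set Tree) (∑ i ∈ I, w i) ^ 2
      ≤ ∑ S ∈ F.1, (K : ℝ) * ∑ i ∈ I, pathSum (S : Set Tree) (w i) ^ 2 := by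
        refine sum_le_sum fun S hS => ?_
        rw [map_sum]
        let J := I.filter fun i => pathSum (S : Set Tree) (w i) ≠ 0
        have hJ : #J ≤ K := h S (F.isPath hS) J (filter_subset _ _) fun i hi =>
          (mem_filter.1 hi).2
        have h1 : ∑ i ∈ I, pathSum (S : Set Tree) (w i) = ∑ i ∈ J, pathSum (S : Set Tree) (w i) :=
          (sum_filter_ne_zero I).symm
        rw [h1]
        refine sq_sum_le_card_mul_sum_sq.trans ?_
        refine mul_le_mul (by exact_mod_cast hJ) ?_ (sum_nonneg fun _ _ => sq_nonneg _)
          (Nat.cast_nonneg K)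
        exact sum_le_sum_of_subset_of_nonneg (filter_subset _ _) fun _ _ _ => sq_nonneg _
    _ = K * ∑ i ∈ I, ∑ S ∈ F.1, pathSum (S : Set Tree) (w i) ^ 2 := by
        rw [← mul_sum, sum_comm]
    _ ≤ K * ∑ i ∈ I, ‖w i‖ ^ 2 := by
        gcongr with i _
        exact F.sum_sq_le (w i)

/-- Upper `ℓ²` estimate for functions supported in disjoint subtrees. -/
theorem norm_sum_cone_sq_le {A : Finset Tree} (hA : IsAntichainNodes A) (w : Tree → FinSupp)
    (hw : ∀ t ∈ A, ∀ s, (w t).coeff s ≠ 0 → t <+: s) :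
    ‖∑ t ∈ A, w t‖ ^ 2 ≤ ∑ t ∈ A, ‖w t‖ ^ 2 := by
  have h := norm_sum_sq_le A w 1 ?_
  · simpa using h
  · intro S hS J hJ hne
    rw [card_le_one]
    intro s hs t ht
    obtain ⟨a, ha, ha'⟩ := exists_mem_of_pathSum_ne (hne s hs)
    obtain ⟨b, hb, hb'⟩ := exists_mem_of_pathSum_ne (hne t ht)
    have h1 := hw s (hJ hs) a ha'
    have h2 := hw t (hJ ht) b hb'
    refine hA (hJ hs) (hJ ht) ?_
    rcases hS.1 ha hb with h | h
    · exact List.prefix_or_prefix_of_prefix (h1.trans h) h2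
    · exact List.prefix_or_prefix_of_prefix h1 (h2.trans h)

/-- Lower `ℓ²` estimate for the restrictions of a function to disjoint subtrees. -/
theorem sum_norm_restrict_cone_sq_le {A : Finset Tree} (hA : IsAntichainNodes A) (w : FinSupp) :
    ∑ t ∈ A, ‖restrict (cone t) w‖ ^ 2 ≤ 2 * ‖w‖ ^ 2 := by
  choose F hF using fun t => exists_norm_sq_le (restrict (cone t) w)
  have h1 : ∑ x ∈ A.sigma fun t => (F t).1, pathSum ((x.2 : Set Tree) ∩ cone x.1) w ^ 2
      ≤ ‖w‖ ^ 2 := by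
    refine sum_sq_pathSum_le (A.sigma fun t => (F t).1)
      (fun x : (_ : Tree) × Finset Tree => (x.2 : Set Tree) ∩ cone x.1) ?_ ?_ w
    · intro x hx
      exact ((F x.1).isPath (mem_sigma.1 hx).2).inter (ordConvex_cone _)
    · rintro ⟨s, S⟩ hx ⟨t, T⟩ hy hxy
      obtain ⟨hs, hS⟩ := mem_sigma.1 (mem_coe.1 hx)
      obtain ⟨ht, hT⟩ := mem_sigma.1 (mem_coe.1 hy)
      refine Set.disjoint_left.2 fun r h1 h2 => ?_
      have hst : s = t := hA hs ht (comparable_of_mem_cone h1.2 h2.2)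
      subst hst
      refine Set.disjoint_left.1 ((F s).pairwiseDisjoint hS hT ?_) h1.1 h2.1
      rintro rfl
      exact hxy rfl
  rw [sum_sigma] at h1
  calc ∑ t ∈ A, ‖restrict (cone t) w‖ ^ 2
      ≤ ∑ t ∈ A, 2 * ∑ S ∈ (F t).1, pathSum ((S : Set Tree) ∩ cone t) w ^ 2 := by
        refine sum_le_sum fun t _ => ?_
        simpa only [pathSum_restrict] using hF t
    _ ≤ 2 * ‖w‖ ^ 2 := by
        rw [← mul_sum]
        linarith

/-! ### Branches -/

/-- The node of level `n` on the branch given by the sequence of signs `β`. -/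
def node (β : ℕ → Bool) (n : ℕ) : Tree := (List.range n).map β

/-- The branch given by the sequence of signs `β`. -/
def branch (β : ℕ → Bool) : Set Tree := {t | t = node β t.length}

@[simp] theorem length_node (β : ℕ → Bool) (n : ℕ) : (node β n).length = n := by simp [node]

theorem node_mem_branch (β : ℕ → Bool) (n : ℕ) : node β n ∈ branch β := by
  simp [branch]

theorem node_prefix_node (β : ℕ → Bool) {m n : ℕ} (h : m ≤ n) : node β m <+: node β n := by
  rw [List.prefix_iff_eq_take, length_node, node, node, ← List.map_take, List.take_range,
    min_eq_left h]

theorem mem_branch_of_prefix {β : ℕ → Bool} {s t : Tree} (ht : t ∈ branch β) (h : s <+: t) :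
    s ∈ branch β := by
  have h1 : node β s.length <+: t := by
    conv_rhs => rw [ht]
    exact node_prefix_node β h.length_le
  rcases List.prefix_or_prefix_of_prefix h h1 with h2 | h2
  · exact h2.eq_of_length (length_node _ _).symm
  · exact (h2.eq_of_length (length_node _ _)).symm

theorem prefix_of_mem_branch {β : ℕ → Bool} {s t : Tree} (hs : s ∈ branch β) (ht : t ∈ branch β)
    (h : s.length ≤ t.length) : s <+: t := by
  rw [hs, ht]
  exact node_prefix_node β h

theorem isPath_branch (β : ℕ → Bool) : IsPath (branch β) :=
  ⟨fun s t hs ht => (le_total s.length t.length).imp (prefix_of_mem_branch hs ht)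
    (prefix_of_mem_branch ht hs), fun _ _ _ _ ht _ h => mem_branch_of_prefix ht h⟩

/-- Every chain of nodes lies on a branch. -/
theorem exists_subset_branch {C : Set Tree} (hC : ∀ s ∈ C, ∀ t ∈ C, Comparable s t) :
    ∃ β, C ⊆ branch β := by
  classical
  have h : ∀ n : ℕ, ∃ b : Bool, ∀ t ∈ C, ∀ hn : n < t.length, t[n] = b := by
    intro n
    by_cases hn : ∃ t ∈ C, n < t.length
    · obtain ⟨t, ht, hnt⟩ := hn
      refine ⟨t[n], fun s hs hns => ?_⟩
      rcases hC s hs t ht with h | h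
      · exact h.getElem hns
      · exact (h.getElem hnt).symm
    · exact ⟨true, fun t ht hnt => absurd ⟨t, ht, hnt⟩ hn⟩
  choose β hβ using h
  refine ⟨β, fun t ht => List.ext_getElem (length_node _ _).symm fun n h1 h2 => ?_⟩
  rw [hβ n t ht h1]
  simp [node]

/-! ### Restrictions of a functional to the subtrees -/

/-- The norm of the restriction of the functional `g` to the functions supported in the subtree
above `t`. -/
noncomputable def coneNorm (g : StrongDual ℝ FinSupp) (t : Tree) : ℝ :=
  ‖g.comp ((restrict (cone t)).mkContinuous 1 fun w => by
    rw [one_mul]; exact norm_restrict_le (ordConvex_cone t) w)‖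

theorem coneNorm_nonneg (g : StrongDual ℝ FinSupp) (t : Tree) : 0 ≤ coneNorm g t := norm_nonneg _

theorem abs_apply_le_coneNorm (g : StrongDual ℝ FinSupp) {t : Tree} {w : FinSupp}
    (hw : ∀ s, w.coeff s ≠ 0 → t <+: s) : |g w| ≤ coneNorm g t * ‖w‖ := by
  have h := (g.comp ((restrict (cone t)).mkContinuous 1 fun w => by
    rw [one_mul]; exact norm_restrict_le (ordConvex_cone t) w)).le_opNorm w
  rw [ContinuousLinearMap.comp_apply, LinearMap.mkContinuous_apply,
    restrict_eq_self (P := cone t) hw] at h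
  exact h

/-- Up to a factor the norm of the restriction to a subtree is attained; the norming function is
scaled so that such functions for disjoint subtrees can be summed. -/
theorem exists_le_apply_of_coneNorm (g : StrongDual ℝ FinSupp) (t : Tree) :
    ∃ v : FinSupp, (∀ s, v.coeff s ≠ 0 → t <+: s) ∧ ‖v‖ ≤ coneNorm g t ∧
      coneNorm g t ^ 2 / 2 ≤ g v := by
  rcases (coneNorm_nonneg g t).eq_or_lt with h0 | hpos
  · refine ⟨0, fun s hs => absurd rfl hs, ?_, ?_⟩
    · rw [norm_zero, ← h0]
    · rw [← h0, map_zero]; norm_num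
  have hlt : coneNorm g t / 2 < coneNorm g t := by linarith
  obtain ⟨x, hx, hgx⟩ := ContinuousLinearMap.exists_lt_apply_of_lt_opNorm _ hlt
  rw [ContinuousLinearMap.comp_apply, LinearMap.mkContinuous_apply, Real.norm_eq_abs] at hgx
  have hn : ‖restrict (cone t) x‖ ≤ 1 := (norm_restrict_le (ordConvex_cone t) x).trans hx.le
  obtain ⟨σ, hσ, hσg⟩ : ∃ σ : ℝ, |σ| = 1 ∧ |g (restrict (cone t) x)| =
      σ * g (restrict (cone t) x) := by
    rcases abs_choice (g (restrict (cone t) x)) with h | h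
    · exact ⟨1, by simp, by rw [h, one_mul]⟩
    · exact ⟨-1, by simp, by rw [h, neg_one_mul]⟩
  refine ⟨(coneNorm g t * σ) • restrict (cone t) x, fun s hs => ?_, ?_, ?_⟩
  · rw [FinSupp.coeff_smul] at hs
    exact mem_of_coeff_restrict_ne (right_ne_zero_of_mul hs)
  · rw [norm_smul, Real.norm_eq_abs, abs_mul, hσ, mul_one, abs_of_pos hpos]
    exact mul_le_of_le_one_right hpos.le hn
  · rw [map_smul, smul_eq_mul, mul_assoc, ← hσg]
    nlinarith

/-- The dual of the upper `ℓ²` estimate for disjoint subtrees. -/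
theorem sum_coneNorm_sq_le (g : StrongDual ℝ FinSupp) {A : Finset Tree}
    (hA : IsAntichainNodes A) : ∑ t ∈ A, coneNorm g t ^ 2 ≤ 4 * ‖g‖ ^ 2 := by
  choose v hv hvn hgv using exists_le_apply_of_coneNorm g
  set X := ∑ t ∈ A, coneNorm g t ^ 2 with hX
  have h1 : ‖∑ t ∈ A, v t‖ ^ 2 ≤ X :=
    (norm_sum_cone_sq_le hA v fun t _ => hv t).trans <|
      sum_le_sum fun t _ => pow_le_pow_left₀ (norm_nonneg _) (hvn t) 2
  have h2 : X / 2 ≤ ‖g‖ * ‖∑ t ∈ A, v t‖ := by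
    refine le_trans ?_ ((le_abs_self _).trans (g.le_opNorm _))
    rw [map_sum, hX, sum_div]
    exact sum_le_sum fun t _ => hgv t
  have hX0 : 0 ≤ X := sum_nonneg fun _ _ => sq_nonneg _
  have h3 : (X / 2) ^ 2 ≤ ‖g‖ ^ 2 * X := by
    calc (X / 2) ^ 2 ≤ (‖g‖ * ‖∑ t ∈ A, v t‖) ^ 2 := pow_le_pow_left₀ (by positivity) h2 2
      _ ≤ ‖g‖ ^ 2 * X := by rw [mul_pow]; gcongr
  by_contra! h
  have : 0 < X := lt_of_le_of_lt (by positivity) h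
  nlinarith

/-- Far up in the tree the restrictions of a functional to the subtrees are small, except along
finitely many branches: the nodes with a restriction of norm greater than `θ` contain a largest
antichain, and above each of its members they form a chain. -/
theorem exists_branches_coneNorm_le (g : StrongDual ℝ FinSupp) {θ : ℝ} (hθ : 0 < θ) :
    ∃ (𝓑 : Finset (ℕ → Bool)) (N : ℕ), ∀ t : Tree, N ≤ t.length →
      (∀ β ∈ 𝓑, t ∉ branch β) → coneNorm g t ≤ θ := by
  classical
  -- The sizes of the antichains of nodes with a restriction of norm greater than `θ`.
  let D : Set ℕ := {n | ∃ A : Finset Tree, IsAntichainNodes A ∧ (∀ t ∈ A, θ < coneNorm g t) ∧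
    #A = n}
  have hD0 : D.Nonempty := ⟨0, ∅, fun s hs => absurd hs (notMem_empty s), by simp, rfl⟩
  have hDb : BddAbove D := by
    refine ⟨⌈4 * ‖g‖ ^ 2 / θ ^ 2⌉₊, ?_⟩
    rintro n ⟨A, hA, hAθ, rfl⟩
    have h : (#A : ℝ) * θ ^ 2 ≤ 4 * ‖g‖ ^ 2 := by
      refine le_trans ?_ (sum_coneNorm_sq_le g hA)
      rw [← nsmul_eq_mul]
      exact card_nsmul_le_sum _ _ _ fun t ht => pow_le_pow_left₀ hθ.le (hAθ t ht).le 2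
    have h2 : (#A : ℝ) ≤ 4 * ‖g‖ ^ 2 / θ ^ 2 := by rwa [le_div_iff₀ (by positivity)]
    exact_mod_cast h2.trans (Nat.le_ceil _)
  obtain ⟨A, hA, hAθ, hcard⟩ := Nat.sSup_mem hD0 hDb
  have hmax : ∀ A' : Finset Tree, IsAntichainNodes A' → (∀ t ∈ A', θ < coneNorm g t) →
      #A' ≤ #A := fun A' h1 h2 => hcard ▸ le_csSup hDb ⟨A', h1, h2, rfl⟩
  let N := A.sup List.length + 1
  have hN : ∀ a ∈ A, ∀ t : Tree, N ≤ t.length → Comparable a t → a <+: t := by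
    intro a ha t ht h
    rcases h with h | h
    · exact h
    · have h1 : a.length ≤ A.sup List.length := le_sup (f := List.length) ha
      have h2 := h.length_le
      exact absurd ht (by omega)
  have hbelow : ∀ t : Tree, N ≤ t.length → θ < coneNorm g t → ∃ a ∈ A, a <+: t := by
    intro t ht htθ
    by_contra! h
    have htA : t ∉ A := fun h' => h t h' List.prefix_rfl
    have h1 := hmax (insert t A) ?_ ?_
    · rw [card_insert_of_notMem htA] at h1
      omega
    · intro r hr s hs hrs
      rcases mem_insert.1 hr with h1 | h1 <;> rcases mem_insert.1 hs with h2 | h2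
      · rw [h1, h2]
      · exact absurd (hN s h2 t ht (h1 ▸ hrs.symm)) (h s h2)
      · exact absurd (hN r h1 t ht (h2 ▸ hrs)) (h r h1)
      · exact hA h1 h2 hrs
    · intro s hs
      rcases mem_insert.1 hs with rfl | hs
      · exact htθ
      · exact hAθ s hs
  let C : Tree → Set Tree := fun a => {t | N ≤ t.length ∧ θ < coneNorm g t ∧ a <+: t}
  have hC : ∀ a ∈ A, ∀ s ∈ C a, ∀ t ∈ C a, Comparable s t := by
    intro a ha s hs t ht
    by_contra hst
    have huniq : ∀ b ∈ A.erase a, ∀ r ∈ C a, ¬ Comparable b r := by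
      intro b hb r hr h
      exact (mem_erase.1 hb).1 (hA (mem_erase.1 hb).2 ha
        (List.prefix_or_prefix_of_prefix (hN b (mem_erase.1 hb).2 r hr.1 h) hr.2.2))
    have hrefl : ∀ r : Tree, Comparable r r := fun r => Or.inl List.prefix_rfl
    have hne : s ≠ t := fun h => hst (h ▸ hrefl s)
    have hsA : s ∉ A.erase a := fun h => huniq s h s hs (hrefl s)
    have htA : t ∉ A.erase a := fun h => huniq t h t ht (hrefl t)
    have h1 := hmax (insert s (insert t (A.erase a))) ?_ ?_
    · rw [card_insert_of_notMem (by simp only [mem_insert, hne, hsA, or_self, not_false_eq_true]),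
        card_insert_of_notMem htA, card_erase_of_mem ha] at h1
      have := card_pos.2 ⟨a, ha⟩
      omega
    · intro p hp q hq hpq
      simp only [mem_insert] at hp hq
      rcases hp with h1 | h1 | h1 <;> rcases hq with h2 | h2 | h2
      · rw [h1, h2]
      · exact absurd (h1 ▸ h2 ▸ hpq) hst
      · exact absurd (h1 ▸ hpq.symm) (huniq q h2 s hs)
      · exact absurd (h1 ▸ h2 ▸ hpq.symm) hst
      · rw [h1, h2]
      · exact absurd (h1 ▸ hpq.symm) (huniq q h2 t ht)
      · exact absurd (h2 ▸ hpq) (huniq p h1 s hs)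
      · exact absurd (h2 ▸ hpq) (huniq p h1 t ht)
      · exact hA (mem_erase.1 h1).2 (mem_erase.1 h2).2 hpq
    · intro p hp
      rcases mem_insert.1 hp with rfl | hp
      · exact hs.2.1
      · rcases mem_insert.1 hp with rfl | hp
        · exact ht.2.1
        · exact hAθ p (mem_erase.1 hp).2
  choose! β hβ using fun a (ha : a ∈ A) => exists_subset_branch (hC a ha)
  refine ⟨A.image β, N, fun t ht hoff => ?_⟩
  by_contra! hlt
  obtain ⟨a, ha, hat⟩ := hbelow t ht hlt
  exact hoff (β a) (mem_image_of_mem β ha) (hβ a ha ⟨ht, hlt, hat⟩)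

/-! ### Functionals off finitely many branches -/

/-- A functional is small on flat functions: those on which all sums along paths are small. -/
theorem exists_flat_bound (g : StrongDual ℝ FinSupp) {η K : ℝ} (hη : 0 < η) :
    ∃ θ > 0, ∀ w : FinSupp, ‖w‖ ^ 2 ≤ K → (∀ P, IsPath P → |pathSum P w| ≤ θ) → g w < η := by
  by_contra! h
  have hK : 0 ≤ K := by
    obtain ⟨w, hw, -⟩ := h 1 one_pos
    exact (sq_nonneg _).trans hw
  -- The cross terms between `z` and a flat `w` are at most `2 θ` times the `ℓ¹` norm of `z`.
  have hz : ∀ k : ℕ, ∃ z : FinSupp, k * η ≤ g z ∧ ‖z‖ ^ 2 ≤ k * (K + 1) := by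
    intro k
    induction k with
    | zero => exact ⟨0, by simp, by simp⟩
    | succ k ih =>
      obtain ⟨z, hgz, hz⟩ := ih
      set C := ∑ t ∈ z.supp, |z.coeff t| with hC
      have hC0 : 0 ≤ C := sum_nonneg fun _ _ => abs_nonneg _
      obtain ⟨w, hw, hflat, hgw⟩ := h (1 / (2 * (C + 1))) (by positivity)
      refine ⟨z + w, ?_, ?_⟩
      · rw [map_add]; push_cast; linarith
      refine norm_sq_le fun F => ?_
      have hl1 : ∑ S ∈ F.1, |pathSum (S : Set Tree) z| ≤ C := by
        classical
        calc ∑ S ∈ F.1, |pathSum (S : Set Tree) z|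
            ≤ ∑ S ∈ F.1, ∑ t ∈ S, |z.coeff t| :=
              sum_le_sum fun S _ => by rw [pathSum_coe]; exact abs_sum_le_sum_abs _ _
          _ = ∑ t ∈ F.1.biUnion id, |z.coeff t| := (sum_biUnion F.2.2).symm
          _ ≤ ∑ t ∈ F.1.biUnion id ∪ z.supp, |z.coeff t| :=
              sum_le_sum_of_subset_of_nonneg subset_union_left fun _ _ _ => abs_nonneg _
          _ = C := (sum_subset subset_union_right fun t _ ht => by
              rw [not_not.1 fun h => ht (FinSupp.mem_supp.2 h), abs_zero]).symm
      calc ∑ S ∈ F.1, pathSum (S : Set Tree) (z + w) ^ 2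
          ≤ ∑ S ∈ F.1, (pathSum (S : Set Tree) z ^ 2 + pathSum (S : Set Tree) w ^ 2 +
              |pathSum (S : Set Tree) z| * (1 / (C + 1))) := by
            refine sum_le_sum fun S hS => ?_
            rw [map_add]
            have h1 := hflat S (F.isPath hS)
            have h2 : pathSum (S : Set Tree) z * pathSum (S : Set Tree) w ≤
                |pathSum (S : Set Tree) z| * (1 / (2 * (C + 1))) := by
              refine (le_abs_self _).trans ?_
              rw [abs_mul]
              gcongr
            have h3 : (1 : ℝ) / (C + 1) = 2 * (1 / (2 * (C + 1))) := by field_simp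
            rw [h3]
            nlinarith
        _ ≤ ‖z‖ ^ 2 + ‖w‖ ^ 2 + C * (1 / (C + 1)) := by
            rw [sum_add_distrib, sum_add_distrib, ← sum_mul]
            gcongr
            · exact F.sum_sq_le z
            · exact F.sum_sq_le w
        _ ≤ k * (K + 1) + K + 1 := by
            have : C * (1 / (C + 1)) ≤ 1 := by
              rw [mul_one_div, div_le_one (by positivity)]; linarith
            linarith
        _ = (k + 1 : ℕ) * (K + 1) := by push_cast; ring
  obtain ⟨k, hk⟩ := exists_nat_gt (‖g‖ ^ 2 * (K + 1) / η ^ 2)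
  obtain ⟨z, hgz, hz⟩ := hz k
  have hk0 : (0 : ℝ) < k := lt_of_le_of_lt (by positivity) hk
  rw [div_lt_iff₀ (by positivity)] at hk
  have h1 : k * η ≤ ‖g‖ * ‖z‖ := hgz.trans ((le_abs_self _).trans (g.le_opNorm z))
  have h2 : (k * η) ^ 2 ≤ ‖g‖ ^ 2 * (k * (K + 1)) := by
    calc (k * η) ^ 2 ≤ (‖g‖ * ‖z‖) ^ 2 := pow_le_pow_left₀ (by positivity) h1 2
      _ ≤ _ := by rw [mul_pow]; gcongr
  nlinarith

open Classical in
/-- The nodes of level `N` that lie on none of the branches in `𝓑`. -/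
noncomputable def levelOff (𝓑 : Finset (ℕ → Bool)) (N : ℕ) : Finset Tree :=
  (level N).filter fun t => ∀ β ∈ 𝓑, t ∉ branch β

theorem levelOff_subset (𝓑 : Finset (ℕ → Bool)) (N : ℕ) : levelOff 𝓑 N ⊆ level N := by
  classical exact filter_subset _ _

theorem mem_levelOff {𝓑 : Finset (ℕ → Bool)} {N : ℕ} {t : Tree} :
    t ∈ levelOff 𝓑 N ↔ t.length = N ∧ ∀ β ∈ 𝓑, t ∉ branch β := by
  classical rw [levelOff, mem_filter, mem_level]

/-- Off finitely many branches the restrictions of a functional to the subtrees at a high level are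
small in the `ℓ²` sense: otherwise their norming functions would add up to a flat function on which
the functional is large. -/
theorem exists_branches_sum_coneNorm_le (g : StrongDual ℝ FinSupp) {η : ℝ} (hη : 0 < η) :
    ∃ (𝓑 : Finset (ℕ → Bool)) (N₀ : ℕ), ∀ N ≥ N₀,
      ∑ t ∈ levelOff 𝓑 N, coneNorm g t ^ 2 ≤ η := by
  obtain ⟨θ, hθ, hflat⟩ := exists_flat_bound g (K := 4 * ‖g‖ ^ 2) (half_pos hη)
  obtain ⟨𝓑, N₀, h𝓑⟩ := exists_branches_coneNorm_le g hθ
  refine ⟨𝓑, N₀, fun N hN => ?_⟩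
  have hA := isAntichainNodes_of_subset_level (levelOff_subset 𝓑 N)
  choose v hv hvn hgv using exists_le_apply_of_coneNorm g
  have h := hflat (∑ t ∈ levelOff 𝓑 N, v t) ?_ ?_
  · have h1 : (∑ t ∈ levelOff 𝓑 N, coneNorm g t ^ 2) / 2 ≤ g (∑ t ∈ levelOff 𝓑 N, v t) := by
      rw [map_sum, sum_div]
      exact sum_le_sum fun t _ => hgv t
    linarith
  · refine (norm_sum_cone_sq_le hA v fun t _ => hv t).trans ?_
    refine le_trans (sum_le_sum fun t _ => ?_) (sum_coneNorm_sq_le g hA)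
    exact pow_le_pow_left₀ (norm_nonneg _) (hvn t) 2
  · intro P hP
    rw [map_sum]
    by_cases h0 : ∃ t ∈ levelOff 𝓑 N, pathSum P (v t) ≠ 0
    · obtain ⟨t, ht, hne⟩ := h0
      rw [sum_eq_single_of_mem t ht]
      · refine (abs_pathSum_le hP _).trans ((hvn t).trans ?_)
        obtain ⟨h1, h2⟩ := mem_levelOff.1 ht
        exact h𝓑 t (hN.trans h1.ge) h2
      · intro s hs hst
        by_contra hne'
        obtain ⟨a, ha, ha'⟩ := exists_mem_of_pathSum_ne hne
        obtain ⟨b, hb, hb'⟩ := exists_mem_of_pathSum_ne hne'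
        refine hst (hA hs ht ?_)
        rcases hP.1 ha hb with h | h
        · exact List.prefix_or_prefix_of_prefix (hv s b hb') ((hv t a ha').trans h)
        · exact List.prefix_or_prefix_of_prefix ((hv s b hb').trans h) (hv t a ha')
    · push Not at h0
      rw [sum_eq_zero h0, abs_zero]
      exact hθ.le

/-- A functional is small on the functions supported far up along a branch whose sum over the
branch vanishes: a segment sees at most two members of a sequence of such functions with successive
supports, since it contains the whole piece of the branch between the first and the last one that
it meets. -/
theorem exists_node_bound (g : StrongDual ℝ FinSupp) (β : ℕ → Bool) {η : ℝ} (hη : 0 < η) :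
    ∃ N : ℕ, ∀ w : FinSupp, (∀ t, w.coeff t ≠ 0 → node β N <+: t) → pathSum (branch β) w = 0 →
      |g w| ≤ η * ‖w‖ := by
  by_contra! h
  have h' : ∀ N : ℕ, ∃ w : FinSupp, (∀ t, w.coeff t ≠ 0 → node β N <+: t) ∧
      pathSum (branch β) w = 0 ∧ ‖w‖ ≤ 1 ∧ η ≤ g w := by
    intro N
    obtain ⟨w, hw, hsum, hg⟩ := h N
    have hw0 : 0 < ‖w‖ := by
      rw [norm_pos_iff]
      rintro rfl
      simp at hg
    obtain ⟨σ, hσ, hσg⟩ : ∃ σ : ℝ, |σ| = 1 ∧ |g w| = σ * g w := by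
      rcases abs_choice (g w) with h | h
      · exact ⟨1, by simp, by rw [h, one_mul]⟩
      · exact ⟨-1, by simp, by rw [h, neg_one_mul]⟩
    refine ⟨(‖w‖⁻¹ * σ) • w, fun t ht => ?_, ?_, ?_, ?_⟩
    · rw [FinSupp.coeff_smul] at ht
      exact hw t (right_ne_zero_of_mul ht)
    · rw [map_smul, hsum, smul_zero]
    · rw [norm_smul, Real.norm_eq_abs, abs_mul, hσ, mul_one, abs_of_pos (inv_pos.2 hw0),
        inv_mul_cancel₀ hw0.ne']
    · rw [map_smul, smul_eq_mul, mul_assoc, ← hσg, ← div_eq_inv_mul, le_div_iff₀ hw0]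
      exact hg.le
  choose f hf hfsum hfn hfg using h'
  -- The function `f (pos i)` is supported on the levels from `pos i` to `pos (i + 1) - 1`.
  choose M hM using exists_length_lt
  let pos : ℕ → ℕ := fun i => Nat.rec 0 (fun _ p => max p (M (f p))) i
  have hpos : ∀ i, pos (i + 1) = max (pos i) (M (f (pos i))) := fun i => rfl
  have hmono : Monotone pos := monotone_nat_of_le_succ fun i => by
    rw [hpos]; exact le_max_left _ _
  have hlt : ∀ i t, (f (pos i)).coeff t ≠ 0 → t.length < pos (i + 1) := fun i t ht =>
    (hM _ t ht).trans_le (by rw [hpos]; exact le_max_right _ _)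
  have hle : ∀ i t, (f (pos i)).coeff t ≠ 0 → pos i ≤ t.length := fun i t ht => by
    simpa using (hf _ t ht).length_le
  have hmid : ∀ S, IsPath S → ∀ i j k, i < j → j < k → pathSum S (f (pos i)) ≠ 0 →
      pathSum S (f (pos k)) ≠ 0 → pathSum S (f (pos j)) = 0 := by
    intro S hS i j k hij hjk hi hk
    obtain ⟨a, ha, ha'⟩ := exists_mem_of_pathSum_ne hi
    obtain ⟨c, hc, hc'⟩ := exists_mem_of_pathSum_ne hk
    rw [← hfsum (pos j)]
    refine pathSum_congr fun t ht => ?_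
    have h1 : a.length < t.length :=
      (hlt i a ha').trans_le ((hmono (Nat.succ_le_of_lt hij)).trans (hle j t ht))
    have h2 : t.length < pos k := (hlt j t ht).trans_le (hmono (Nat.succ_le_of_lt hjk))
    have h3 : node β (pos k) <+: c := hf _ c hc'
    have h4 : pos k ≤ c.length := hle k c hc'
    constructor
    · intro htS
      have h5 := hS.prefix_of_length_le htS hc (by omega)
      refine mem_branch_of_prefix (node_mem_branch β (pos k)) ?_
      exact List.prefix_of_prefix_length_le h5 h3 (by simpa using h2.le)
    · intro htβ
      have h5 : t <+: c := (prefix_of_mem_branch htβ (node_mem_branch β (pos k))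
        (by simpa using h2.le)).trans h3
      have h6 : a <+: c := hS.prefix_of_length_le ha hc (by omega)
      exact hS.2 ha hc (List.prefix_of_prefix_length_le h6 h5 h1.le) h5
  have hsum : ∀ k : ℕ, ‖∑ i ∈ range k, f (pos i)‖ ^ 2 ≤ 2 * k := by
    intro k
    refine (norm_sum_sq_le (range k) (fun i => f (pos i)) 2 ?_).trans ?_
    · intro S hS J _ hJ
      rcases J.eq_empty_or_nonempty with rfl | hne
      · simp
      refine le_trans (card_le_card (t := {J.min' hne, J.max' hne}) fun j hj => ?_) card_le_two
      by_contra hj'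
      simp only [mem_insert, mem_singleton, not_or] at hj'
      exact hJ j hj (hmid S hS _ j _ (lt_of_le_of_ne (J.min'_le j hj) (Ne.symm hj'.1))
        (lt_of_le_of_ne (J.le_max' j hj) hj'.2) (hJ _ (J.min'_mem hne)) (hJ _ (J.max'_mem hne)))
    · have : ∑ i ∈ range k, ‖f (pos i)‖ ^ 2 ≤ ∑ i ∈ range k, (1 : ℝ) :=
        sum_le_sum fun i _ => pow_le_one₀ (norm_nonneg _) (hfn _)
      simp at this
      push_cast
      linarith
  obtain ⟨k, hk⟩ := exists_nat_gt (‖g‖ ^ 2 * 2 / η ^ 2)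
  have hk0 : (0 : ℝ) < k := lt_of_le_of_lt (by positivity) hk
  rw [div_lt_iff₀ (by positivity)] at hk
  have h1 : k * η ≤ ‖g‖ * ‖∑ i ∈ range k, f (pos i)‖ := by
    refine le_trans ?_ ((le_abs_self _).trans (g.le_opNorm _))
    rw [map_sum, ← nsmul_eq_mul]
    simpa using card_nsmul_le_sum (range k) (fun i => g (f (pos i))) η fun i _ => hfg _
  have h2 : (k * η) ^ 2 ≤ ‖g‖ ^ 2 * (2 * k) := by
    calc (k * η) ^ 2 ≤ (‖g‖ * ‖∑ i ∈ range k, f (pos i)‖) ^ 2 :=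
          pow_le_pow_left₀ (by positivity) h1 2
      _ ≤ _ := by rw [mul_pow]; gcongr; exact hsum k
  nlinarith

/-- Modulo functions supported on finitely many levels, a functional on the James tree space is
approximated by a combination of finitely many branch sums: it is small on the functions that
are supported far up in the tree and have vanishing sums over suitable finitely many branches. -/
theorem exists_branches_bound (g : StrongDual ℝ FinSupp) {η : ℝ} (hη : 0 < η) :
    ∃ (𝓑 : Finset (ℕ → Bool)) (N : ℕ), ∀ w : FinSupp, (∀ t, w.coeff t ≠ 0 → N ≤ t.length) →
      (∀ β ∈ 𝓑, pathSum (branch β) w = 0) → |g w| ≤ η * ‖w‖ := by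
  classical
  obtain ⟨𝓑, N₁, h𝓑⟩ := exists_branches_sum_coneNorm_le g (η := η ^ 2 / 8) (by positivity)
  have hη' : 0 < η / (2 * (#𝓑 + 1)) := by positivity
  choose N₂ hN₂ using fun β => exists_node_bound g β hη'
  set N := max N₁ (𝓑.sup N₂) with hN
  refine ⟨𝓑, N, fun w hw hsum => ?_⟩
  have hoff : |∑ t ∈ levelOff 𝓑 N, g (restrict (cone t) w)| ≤ η / 2 * ‖w‖ := by
    have h1 : |∑ t ∈ levelOff 𝓑 N, g (restrict (cone t) w)| ≤
        ∑ t ∈ levelOff 𝓑 N, coneNorm g t * ‖restrict (cone t) w‖ :=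
      (abs_sum_le_sum_abs _ _).trans <| sum_le_sum fun t _ =>
        abs_apply_le_coneNorm g fun s hs => mem_of_coeff_restrict_ne hs
    have h2 : (∑ t ∈ levelOff 𝓑 N, coneNorm g t * ‖restrict (cone t) w‖) ^ 2 ≤
        (η / 2 * ‖w‖) ^ 2 := by
      refine (sum_mul_sq_le_sq_mul_sq _ _ _).trans ?_
      have h3 := sum_norm_restrict_cone_sq_le
        (isAntichainNodes_of_subset_level (levelOff_subset 𝓑 N)) w
      calc _ ≤ η ^ 2 / 8 * (2 * ‖w‖ ^ 2) := by
            refine mul_le_mul (h𝓑 N (le_max_left _ _)) h3 (sum_nonneg fun _ _ => sq_nonneg _)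
              (by positivity)
        _ = _ := by ring
    exact h1.trans (le_of_sq_le_sq h2 (by positivity))
  have hon : |∑ t ∈ level N \ levelOff 𝓑 N, g (restrict (cone t) w)| ≤ η / 2 * ‖w‖ := by
    have hmem : ∀ t ∈ level N \ levelOff 𝓑 N, ∃ β ∈ 𝓑, t = node β N := by
      intro t ht
      rw [mem_sdiff, mem_level, mem_levelOff] at ht
      obtain ⟨hl, hno⟩ := ht
      by_contra! hc
      exact hno ⟨hl, fun β hβ hb => hc β hβ (by rw [← hl]; exact hb)⟩
    have hcard : #(level N \ levelOff 𝓑 N) ≤ #𝓑 := by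
      refine (card_le_card (t := 𝓑.image fun β => node β N) fun t ht => ?_).trans card_image_le
      obtain ⟨β, hβ, rfl⟩ := hmem t ht
      exact mem_image_of_mem _ hβ
    have hterm : ∀ t ∈ level N \ levelOff 𝓑 N,
        |g (restrict (cone t) w)| ≤ η / (2 * (#𝓑 + 1)) * ‖w‖ := by
      intro t ht
      obtain ⟨β, hβ, rfl⟩ := hmem t ht
      refine (hN₂ β _ (fun s hs => ?_) ?_).trans ?_
      · have h1 : N₂ β ≤ N := (le_sup hβ).trans (le_max_right _ _)
        exact (node_prefix_node β h1).trans (mem_of_coeff_restrict_ne hs)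
      · rw [pathSum_restrict, ← hsum β hβ]
        refine pathSum_congr fun s hs => ⟨fun h => h.1, fun h => ⟨h, ?_⟩⟩
        exact prefix_of_mem_branch (node_mem_branch β N) h (by simpa using hw s hs)
      · gcongr
        exact norm_restrict_le (ordConvex_cone _) w
    refine (abs_sum_le_sum_abs _ _).trans ((sum_le_card_nsmul _ _ _ hterm).trans ?_)
    rw [nsmul_eq_mul]
    have h1 : (#(level N \ levelOff 𝓑 N) : ℝ) ≤ #𝓑 + 1 := by
      have : (#(level N \ levelOff 𝓑 N) : ℝ) ≤ #𝓑 := by exact_mod_cast hcard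
      linarith
    calc _ ≤ ((#𝓑 : ℝ) + 1) * (η / (2 * (#𝓑 + 1)) * ‖w‖) := by gcongr
      _ = η / 2 * ‖w‖ := by field_simp
  rw [← sum_restrict_cone hw, map_sum, ← sum_sdiff (levelOff_subset 𝓑 N), sum_restrict_cone hw]
  refine (abs_add_le _ _).trans ?_
  linarith

/-! ### Perturbations by functions supported far up in the tree -/

/-- At a node `τ` above the support of `u`, the sums of `u` over the segments ending at `τ`
essentially have one sign: whenever the sum from `p` is smaller than `-η` (up to the sign `σ`), the
sum from some later node `q` is at least `η`. Here `q` is the last node from which the sum has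
absolute value greater than `η`, and `σ` is the sign of that sum. -/
theorem exists_sign (u : FinSupp) (τ : Tree) (η : ℝ) :
    ∃ σ : ℝ, (σ = 1 ∨ σ = -1) ∧ ∀ p, p <+: τ → -η ≤ σ * pathSum (segment p τ) u ∨
      ∃ q, p <+: q ∧ q <+: τ ∧ η ≤ σ * pathSum (segment q τ) u := by
  classical
  let A : Finset Tree := τ.inits.toFinset.filter fun p => η < |pathSum (segment p τ) u|
  have hA : ∀ p, p ∈ A ↔ p <+: τ ∧ η < |pathSum (segment p τ) u| := fun p => by simp [A]
  rcases A.eq_empty_or_nonempty with h0 | hne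
  · refine ⟨1, Or.inl rfl, fun p hp => Or.inl ?_⟩
    have h1 : p ∉ A := h0 ▸ notMem_empty p
    rw [hA] at h1
    push Not at h1
    rw [one_mul]
    exact (abs_le.1 (h1 hp)).1
  · obtain ⟨q, hq, hmax⟩ := exists_max_image A List.length hne
    obtain ⟨hqτ, hqη⟩ := (hA q).1 hq
    obtain ⟨σ, hσ, hσq⟩ : ∃ σ : ℝ, (σ = 1 ∨ σ = -1) ∧
        |pathSum (segment q τ) u| = σ * pathSum (segment q τ) u := by
      rcases abs_choice (pathSum (segment q τ) u) with h | h
      · exact ⟨1, Or.inl rfl, by rw [h, one_mul]⟩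
      · exact ⟨-1, Or.inr rfl, by rw [h, neg_one_mul]⟩
    refine ⟨σ, hσ, fun p hp => ?_⟩
    by_cases hpA : p ∈ A
    · exact Or.inr ⟨q, List.prefix_of_prefix_length_le hp hqτ (hmax p hpA), hqτ,
        by rw [← hσq]; exact hqη.le⟩
    · rw [hA] at hpA
      push Not at hpA
      have h1 := abs_le.1 (hpA hp)
      left
      rcases hσ with rfl | rfl <;> linarith

/-- If `v` is supported above the support of `u`, and the sums of `v` over the paths from a node `τ`
of the separating level are at most `η τ` in absolute value and have the sign opposite to the
essential sign of the sums of `u` over the segments ending at `τ`, then `v` affects the norm of `u` only to second order: a segment of the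
combined function with a significant sum of the wrong sign can be cut into two, so as to increase
the contribution of `u`. -/
theorem norm_add_sq_le {N : ℕ} {u v : FinSupp} (hu : ∀ t, u.coeff t ≠ 0 → t.length < N)
    (hv : ∀ t, v.coeff t ≠ 0 → N ≤ t.length) (σ η : Tree → ℝ)
    (hσ : ∀ τ ∈ level N, σ τ = 1 ∨ σ τ = -1)
    (hσu : ∀ τ ∈ level N, ∀ p, p <+: τ → -η τ ≤ σ τ * pathSum (segment p τ) u ∨
      ∃ q, p <+: q ∧ q <+: τ ∧ η τ ≤ σ τ * pathSum (segment q τ) u)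
    (hσv : ∀ τ ∈ level N, ∀ P, IsPath P → τ ∈ P →
      -η τ ≤ σ τ * pathSum P v ∧ σ τ * pathSum P v ≤ 0) :
    ‖u + v‖ ^ 2 ≤ ‖u‖ ^ 2 + ‖v‖ ^ 2 + 3 * ∑ τ ∈ level N, η τ ^ 2 := by
  classical
  refine norm_sq_le fun F => ?_
  have key : ∀ S ∈ F.1, ∃ P : Bool → Set Tree, (∀ b, IsPath (P b)) ∧ (∀ b, P b ⊆ S) ∧
      Disjoint (P true) (P false) ∧ pathSum (S : Set Tree) (u + v) ^ 2 ≤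
        pathSum (P true) u ^ 2 + pathSum (P false) u ^ 2 + pathSum (S : Set Tree) v ^ 2 +
          3 * ∑ τ ∈ level N with τ ∈ S, η τ ^ 2 := by
    intro S hS
    have hSp := F.isPath hS
    have hnn : 0 ≤ ∑ τ ∈ level N with τ ∈ S, η τ ^ 2 := sum_nonneg fun _ _ => sq_nonneg _
    have hempty : IsPath (∅ : Set Tree) := ⟨fun _ _ h => absurd h (Set.notMem_empty _),
      fun _ _ _ h => absurd h (Set.notMem_empty _)⟩
    -- If `u` or `v` has zero sum over `S`, no cutting is needed.
    have htriv : pathSum (S : Set Tree) u = 0 ∨ pathSum (S : Set Tree) v = 0 →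
        ∃ P : Bool → Set Tree, (∀ b, IsPath (P b)) ∧ (∀ b, P b ⊆ S) ∧
      Disjoint (P true) (P false) ∧ pathSum (S : Set Tree) (u + v) ^ 2 ≤
        pathSum (P true) u ^ 2 + pathSum (P false) u ^ 2 + pathSum (S : Set Tree) v ^ 2 +
          3 * ∑ τ ∈ level N with τ ∈ S, η τ ^ 2 := by
      intro h0
      refine ⟨fun b => if b then S else ∅, fun b => ?_, fun b => ?_, by simp, ?_⟩
      · cases b
        · simpa using hempty
        · simpa using hSp
      · cases b <;> simp
      · rw [map_add]
        have h1 : (0 : ℝ) ≤ pathSum ∅ u ^ 2 := sq_nonneg _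
        rcases h0 with h0 | h0 <;> simp [h0] <;> nlinarith
    by_cases hSu : pathSum (S : Set Tree) u = 0
    · exact htriv (Or.inl hSu)
    by_cases hSv : pathSum (S : Set Tree) v = 0
    · exact htriv (Or.inr hSv)
    obtain ⟨a', ha', hua⟩ := exists_mem_of_pathSum_ne hSu
    obtain ⟨b', hb', hvb⟩ := exists_mem_of_pathSum_ne hSv
    obtain ⟨a, b, -, hSab⟩ := F.2.1 S hS
    have hmS : ∀ t, t ∈ S ↔ a <+: t ∧ t <+: b := fun t => by rw [hSab, mem_segment]
    have hbN : N ≤ b.length := (hv b' hvb).trans ((hmS b').1 hb').2.length_le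
    have haN : a.length < N := ((hmS a').1 ha').1.length_le.trans_lt (hu a' hua)
    set τ := b.take N with hτ
    have hτl : τ.length = N := by rw [hτ, List.length_take, min_eq_left hbN]
    have hτb : τ <+: b := List.take_prefix N b
    have hτN : τ ∈ level N := mem_level.2 hτl
    have hab : a <+: b := ((hmS a').1 ha').1.trans ((hmS a').1 ha').2
    have haτ : a <+: τ := List.prefix_of_prefix_length_le hab hτb (by omega)
    have hτS : τ ∈ S := (hmS τ).2 ⟨haτ, hτb⟩
    have hle : η τ ^ 2 ≤ ∑ τ ∈ level N with τ ∈ S, η τ ^ 2 :=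
      single_le_sum (f := fun τ => η τ ^ 2) (fun _ _ => sq_nonneg _)
        (mem_filter.2 ⟨hτN, hτS⟩)
    have hx : pathSum (S : Set Tree) u = pathSum (segment a τ) u := by
      refine pathSum_congr fun t ht => ?_
      rw [mem_coe, mem_coe, hmS, mem_segment]
      have := hu t ht
      exact ⟨fun h => ⟨h.1, List.prefix_of_prefix_length_le h.2 hτb (by omega)⟩,
        fun h => ⟨h.1, h.2.trans hτb⟩⟩
    obtain ⟨hy1, hy2⟩ := hσv τ hτN S hSp hτS
    rcases le_or_gt (-η τ) (σ τ * pathSum (S : Set Tree) u) with hpos | hneg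
    · refine ⟨fun b => if b then S else ∅, fun b => ?_, fun b => ?_, by simp, ?_⟩
      · cases b
        · simpa using hempty
        · simpa using hSp
      · cases b <;> simp
      · rw [map_add]
        have h1 : (0 : ℝ) ≤ pathSum ∅ u ^ 2 := sq_nonneg _
        have h2 : pathSum (S : Set Tree) u * pathSum (S : Set Tree) v ≤ η τ ^ 2 := by
          rcases hσ τ hτN with h | h <;> rw [h] at hpos hy1 hy2 <;> nlinarith
        simp only [if_true, Bool.false_eq_true, if_false]
        nlinarith
    · obtain ⟨q, haq, hqτ, hq⟩ := (hσu τ hτN a haτ).resolve_left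
        (by rw [← hx]; exact not_le.2 hneg)
      let P : Bool → Set Tree := fun b =>
        if b then (S : Set Tree) ∩ {t | ¬ q <+: t} else (segment q τ : Set Tree)
      have hconv : OrdConvex {t | ¬ q <+: t} := fun r s t _ ht _ h2 h3 => ht (h3.trans h2)
      have hdisj : Disjoint (P true) (P false) := by
        refine Set.disjoint_left.2 fun t h1 h2 => ?_
        simp only [P, if_true, Bool.false_eq_true, if_false, mem_coe, mem_segment] at h1 h2
        exact h1.2 h2.1
      refine ⟨P, fun b => ?_, fun b => ?_, hdisj, ?_⟩
      · cases b
        · exact isPath_segment q τ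
        · exact hSp.inter hconv
      · cases b
        · intro t ht
          have ht' := mem_segment.1 (mem_coe.1 ht)
          exact (hmS t).2 ⟨haq.trans ht'.1, ht'.2.trans hτb⟩
        · exact Set.inter_subset_left
      · have hsplit : pathSum (S : Set Tree) u = pathSum (P true) u + pathSum (P false) u := by
          rw [← pathSum_union hdisj]
          refine pathSum_congr fun t ht => ?_
          have htl := hu t ht
          simp only [P, if_true, Bool.false_eq_true, if_false, Set.mem_union, Set.mem_inter_iff,
            mem_coe, Set.mem_ofPred_eq, mem_segment, hmS]
          constructor
          · intro h
            by_cases hqt : q <+: t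
            · exact Or.inr ⟨hqt, List.prefix_of_prefix_length_le h.2 hτb (by omega)⟩
            · exact Or.inl ⟨h, hqt⟩
          · rintro (h | h)
            · exact h.1
            · exact ⟨haq.trans h.1, h.2.trans hτb⟩
        have hq' : η τ ≤ σ τ * pathSum (P false) u := hq
        rw [hsplit] at hneg
        rw [map_add, hsplit]
        set x₁ := pathSum (P true) u
        set x₂ := pathSum (P false) u
        set y := pathSum (S : Set Tree) v
        have h3 : x₁ * (x₂ + y) ≤ 0 ∧ x₂ * y ≤ 0 := by
          rcases hσ τ hτN with h | h <;> rw [h] at hneg hy1 hy2 hq'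
          · exact ⟨mul_nonpos_of_nonpos_of_nonneg (by linarith) (by linarith),
              mul_nonpos_of_nonneg_of_nonpos (by linarith) (by linarith)⟩
          · exact ⟨mul_nonpos_of_nonneg_of_nonpos (by linarith) (by linarith),
              mul_nonpos_of_nonpos_of_nonneg (by linarith) (by linarith)⟩
        nlinarith [sq_nonneg (η τ)]
  choose! P hP hPS hPd hPle using key
  calc ∑ S ∈ F.1, pathSum (S : Set Tree) (u + v) ^ 2
      ≤ ∑ S ∈ F.1, (pathSum (P S true) u ^ 2 + pathSum (P S false) u ^ 2 +
          pathSum (S : Set Tree) v ^ 2 + 3 * ∑ τ ∈ level N with τ ∈ S, η τ ^ 2) :=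
        sum_le_sum hPle
    _ = ∑ x ∈ F.1 ×ˢ (univ : Finset Bool), pathSum (P x.1 x.2) u ^ 2 +
          ∑ S ∈ F.1, pathSum (S : Set Tree) v ^ 2 +
          3 * ∑ S ∈ F.1, ∑ τ ∈ level N with τ ∈ S, η τ ^ 2 := by
        rw [sum_add_distrib, sum_add_distrib, sum_product, mul_sum]
        simp only [Fintype.sum_bool]
    _ ≤ ‖u‖ ^ 2 + ‖v‖ ^ 2 + 3 * ∑ τ ∈ level N, η τ ^ 2 := by
        gcongr
        · refine sum_sq_pathSum_le _ (fun x : Finset Tree × Bool => P x.1 x.2)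
            (fun x hx => hP _ (mem_product.1 hx).1 _) ?_ u
          rintro ⟨S, b⟩ hx ⟨T, c⟩ hy hne
          have hS := (mem_product.1 (mem_coe.1 hx)).1
          have hT := (mem_product.1 (mem_coe.1 hy)).1
          change Disjoint (P S b) (P T c)
          by_cases hST : S = T
          · subst hST
            cases b <;> cases c
            · exact absurd rfl hne
            · exact (hPd S hS).symm
            · exact hPd S hS
            · exact absurd rfl hne
          · exact (F.pairwiseDisjoint hS hT hST).mono (hPS S hS b) (hPS T hT c)
        · exact F.sum_sq_le v
        · rw [← sum_biUnion]
          · refine sum_le_sum_of_subset_of_nonneg (fun t ht => ?_) fun _ _ _ => sq_nonneg _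
            obtain ⟨S, -, h⟩ := mem_biUnion.1 ht
            exact (mem_filter.1 h).1
          · intro S hS T hT hST
            refine Finset.disjoint_left.2 fun t h1 h2 => ?_
            exact Finset.disjoint_left.1 (F.2.2 hS hT hST) (mem_filter.1 h1).2 (mem_filter.1 h2).2

theorem single_eq_smul (t : Tree) (c : ℝ) : FinSupp.single t c = c • FinSupp.single t 1 := by
  refine FinSupp.ext_coeff fun s => ?_
  classical
  rw [FinSupp.coeff_smul, FinSupp.coeff_single, FinSupp.coeff_single]
  split_ifs <;> simp

theorem sum_single (w : FinSupp) : ∑ t ∈ w.supp, FinSupp.single t (w.coeff t) = w :=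
  Finsupp.sum_single w

theorem apply_single (y : StrongDual ℝ FinSupp) (t : Tree) (c : ℝ) :
    y (FinSupp.single t c) = c * y (FinSupp.single t 1) := by
  rw [single_eq_smul, map_smul, smul_eq_mul]

theorem apply_eq_zero {y : StrongDual ℝ FinSupp} {w : FinSupp}
    (h : ∀ t, w.coeff t ≠ 0 → y (FinSupp.single t 1) = 0) : y w = 0 := by
  rw [← sum_single w, map_sum]
  refine sum_eq_zero fun t ht => ?_
  rw [apply_single, h t (FinSupp.mem_supp.1 ht), mul_zero]

theorem pathSum_branch_eq_zero {β : ℕ → Bool} {τ : Tree} {w : FinSupp}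
    (hw : ∀ s, w.coeff s ≠ 0 → τ <+: s) (hτ : τ ∉ branch β) : pathSum (branch β) w = 0 :=
  pathSum_eq_zero fun s hs hb => hτ (mem_branch_of_prefix hb (hw s hs))

/-- A function `v` supported in the subtree above `τ` can be corrected at `τ`, and far up on the
branch of `𝓑` through `τ` if there is one, so that its sums over the paths from `τ` all have the
sign `-σ` and its sums over the branches in `𝓑` vanish. A functional which vanishes at `τ` and is
often small along the branches of `𝓑` hardly notices the correction. -/
theorem exists_correction (y : StrongDual ℝ FinSupp) {τ : Tree} {v : FinSupp}
    (hv : ∀ s, v.coeff s ≠ 0 → τ <+: s) (hyτ : y (FinSupp.single τ 1) = 0) {σ : ℝ}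
    (hσ : σ = 1 ∨ σ = -1) (𝓑 : Finset (ℕ → Bool))
    (h𝓑 : ∀ β ∈ 𝓑, ∀ γ ∈ 𝓑, τ ∈ branch β → τ ∈ branch γ → β = γ) {δ : ℝ} (hδ : 0 ≤ δ)
    (hy : ∀ β ∈ 𝓑, ∀ M, ∃ n ≥ M, |y (FinSupp.single (node β n) 1)| ≤ δ) :
    ∃ v' : FinSupp, (∀ s, v'.coeff s ≠ 0 → τ <+: s) ∧ ‖v'‖ ≤ 4 * ‖v‖ ∧
      y v - 2 * ‖v‖ * δ ≤ y v' ∧ (∀ β ∈ 𝓑, pathSum (branch β) v' = 0) ∧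
      ∀ P, IsPath P → τ ∈ P → -(2 * ‖v‖) ≤ σ * pathSum P v' ∧ σ * pathSum P v' ≤ 0 := by
  classical
  have hσ1 : |σ| = 1 := by rcases hσ with rfl | rfl <;> simp
  have hσσ : σ * σ = 1 := by rcases hσ with rfl | rfl <;> norm_num
  set e := FinSupp.single τ (-(σ * ‖v‖)) with he
  have hen : ‖e‖ ≤ ‖v‖ := by
    refine (norm_single_le _ _).trans ?_
    rw [abs_neg, abs_mul, hσ1, one_mul, abs_norm]
  have hye : y e = 0 := by rw [he, apply_single, hyτ, mul_zero]
  have hve : ∀ s, (v + e).coeff s ≠ 0 → τ <+: s := by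
    intro s hs
    by_contra hτs
    refine hs ?_
    rw [FinSupp.coeff_add, not_not.1 fun h => hτs (hv s h), he, FinSupp.coeff_single,
      if_neg (by rintro rfl; exact hτs List.prefix_rfl), add_zero]
  have hbound : ∀ P, IsPath P → τ ∈ P →
      -(2 * ‖v‖) ≤ σ * pathSum P (v + e) ∧ σ * pathSum P (v + e) ≤ 0 := by
    intro P hP hτP
    have h1 := abs_le.1 (abs_pathSum_le hP v)
    have h2 : σ * pathSum P (v + e) = σ * pathSum P v - ‖v‖ := by
      rw [map_add, he, pathSum_single_of_mem _ hτP]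
      linear_combination (-‖v‖) * hσσ
    rw [h2]
    rcases hσ with rfl | rfl <;> constructor <;> linarith
  by_cases hon : ∃ β ∈ 𝓑, τ ∈ branch β
  · obtain ⟨β, hβ, hτβ⟩ := hon
    obtain ⟨M, hM⟩ := exists_length_lt (v + e)
    obtain ⟨n, hn, hyn⟩ := hy β hβ (max M (τ.length + 1))
    have hnM : M ≤ n := (le_max_left _ _).trans hn
    have hnτ : τ.length < n := (le_max_right _ _).trans hn
    set d := -pathSum (branch β) (v + e) with hd
    have hdn : |d| ≤ 2 * ‖v‖ := by
      rw [hd, abs_neg]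
      refine (abs_pathSum_le (isPath_branch β) _).trans ((norm_add_le _ _).trans ?_)
      linarith
    have hτn : τ <+: node β n := prefix_of_mem_branch hτβ (node_mem_branch β n)
      (by simpa using hnτ.le)
    have hsupp : ∀ s, (v + e + FinSupp.single (node β n) d).coeff s ≠ 0 → τ <+: s := by
      intro s hs
      by_contra hτs
      refine hs ?_
      rw [FinSupp.coeff_add, not_not.1 fun h => hτs (hve s h), FinSupp.coeff_single,
        if_neg (by rintro rfl; exact hτs hτn), add_zero]
    refine ⟨v + e + FinSupp.single (node β n) d, hsupp, ?_, ?_, ?_, ?_⟩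
    · refine (norm_add₃_le).trans ?_
      linarith [(norm_single_le (node β n) d).trans hdn]
    · rw [map_add, map_add, hye, apply_single]
      have h1 : |d * y (FinSupp.single (node β n) 1)| ≤ 2 * ‖v‖ * δ := by
        rw [abs_mul]
        exact mul_le_mul hdn hyn (abs_nonneg _) (by positivity)
      linarith [(abs_le.1 h1).1]
    · intro γ hγ
      by_cases hτγ : τ ∈ branch γ
      · obtain rfl := h𝓑 β hβ γ hγ hτβ hτγ
        rw [map_add, pathSum_single_of_mem _ (node_mem_branch β n), hd, add_neg_cancel]
      · exact pathSum_branch_eq_zero hsupp hτγ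
    · intro P hP hτP
      by_cases hnP : node β n ∈ P
      · have h1 : pathSum P (v + e) = pathSum (branch β) (v + e) := by
          -- A path through `τ` and the upper correction agrees with the branch on the support.
          refine pathSum_congr fun s hs => ?_
          have hsl : s.length ≤ (node β n).length := by simpa using ((hM s hs).trans_le hnM).le
          refine ⟨fun h => mem_branch_of_prefix (node_mem_branch β n)
            (hP.prefix_of_length_le h hnP hsl), fun h => ?_⟩
          exact hP.2 hτP hnP (hve s hs) (prefix_of_mem_branch h (node_mem_branch β n) hsl)
        rw [map_add, pathSum_single_of_mem _ hnP, h1, hd, add_neg_cancel, mul_zero]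
        exact ⟨by linarith [norm_nonneg v], le_rfl⟩
      · rw [map_add, pathSum_single_of_notMem _ hnP, add_zero]
        exact hbound P hP hτP
  · push Not at hon
    refine ⟨v + e, hve, (norm_add_le _ _).trans (by linarith [norm_nonneg v]), ?_,
      fun β hβ => pathSum_branch_eq_zero hve (hon β hβ), hbound⟩
    rw [map_add, hye]
    have : 0 ≤ 2 * ‖v‖ * δ := by positivity
    linarith

/-- At a high enough level, finitely many branches pass through different nodes. -/
theorem exists_level_separating (𝓑 : Finset (ℕ → Bool)) :
    ∃ N : ℕ, ∀ τ : Tree, N ≤ τ.length → ∀ β ∈ 𝓑, ∀ γ ∈ 𝓑, τ ∈ branch β → τ ∈ branch γ → β = γ := by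
  have h : ∀ p : (ℕ → Bool) × (ℕ → Bool), ∃ n, p.1 n = p.2 n → p.1 = p.2 := by
    intro p
    by_contra! hp
    exact (hp 0).2 (funext fun n => (hp n).1)
  choose d hd using h
  refine ⟨(𝓑 ×ˢ 𝓑).sup d + 1, fun τ hτ β hβ γ hγ h1 h2 => hd (β, γ) ?_⟩
  have hlt : d (β, γ) < τ.length :=
    lt_of_lt_of_le (Nat.lt_succ_of_le (le_sup (f := d) (mk_mem_product hβ hγ))) hτ
  have h3 : node β τ.length = node γ τ.length := h1.symm.trans h2
  have h4 : (node β τ.length)[d (β, γ)]? = (node γ τ.length)[d (β, γ)]? := by rw [h3]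
  simpa [node, List.getElem?_range hlt] using h4

/-- Let `u` be supported below level `N`, and let `y` be a norm one functional which vanishes up to
level `N` and is often small along each of finitely many branches separated at level `N`. Then
there is a function `v`, supported from level `N` on and with vanishing sums over these branches,
on which `y` is large, and which affects the norm of `u` only to second order. -/
theorem exists_perturbation {N : ℕ} {u : FinSupp} (hu : ∀ t, u.coeff t ≠ 0 → t.length < N)
    {y : StrongDual ℝ FinSupp} (hy1 : ‖y‖ = 1)
    (hyN : ∀ t : Tree, t.length ≤ N → y (FinSupp.single t 1) = 0) (𝓑 : Finset (ℕ → Bool))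
    (h𝓑 : ∀ τ : Tree, N ≤ τ.length → ∀ β ∈ 𝓑, ∀ γ ∈ 𝓑, τ ∈ branch β → τ ∈ branch γ → β = γ)
    (hy : ∀ β ∈ 𝓑, ∀ δ > 0, ∀ M, ∃ n ≥ M, |y (FinSupp.single (node β n) 1)| ≤ δ)
    {α : ℝ} (hα : 0 < α) :
    ∃ v : FinSupp, (∀ t, v.coeff t ≠ 0 → N ≤ t.length) ∧
      (∀ β ∈ 𝓑, pathSum (branch β) v = 0) ∧ ‖v‖ ≤ 6 ∧ 1 / 4 ≤ y v ∧
      ‖u + α • v‖ ^ 2 ≤ ‖u‖ ^ 2 + 56 * α ^ 2 := by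
  classical
  obtain ⟨v₀, hv₀, hyv₀⟩ : ∃ v₀ : FinSupp, ‖v₀‖ ≤ 1 ∧ 1 / 2 ≤ y v₀ := by
    obtain ⟨x, hx, hyx⟩ := y.exists_lt_apply_of_lt_opNorm (r := 1 / 2) (by rw [hy1]; norm_num)
    rw [Real.norm_eq_abs] at hyx
    rcases abs_choice (y x) with h | h
    · exact ⟨x, hx.le, by rw [← h]; exact hyx.le⟩
    · exact ⟨-x, by rw [norm_neg]; exact hx.le, by rw [map_neg, ← h]; exact hyx.le⟩
  set v₁ := restrict (levelsFrom N) v₀ with hv₁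
  have hv₁s : ∀ t, v₁.coeff t ≠ 0 → N ≤ t.length := fun t ht => mem_of_coeff_restrict_ne ht
  have hv₁n : ‖v₁‖ ≤ 1 := (norm_restrict_le (ordConvex_levelsFrom N) v₀).trans hv₀
  have hyv₁ : 1 / 2 ≤ y v₁ := by
    have h : y (v₀ - v₁) = 0 := by
      refine apply_eq_zero fun t ht => hyN t ?_
      by_contra! hlt
      refine ht ?_
      have h1 : v₁.coeff t = v₀.coeff t := coeff_restrict_of_mem v₀ hlt.le
      change v₀.coeff t - v₁.coeff t = 0
      rw [h1, sub_self]
    rw [map_sub] at h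
    linarith
  let A : Tree → ℝ := fun τ => ‖restrict (cone τ) v₁‖
  have hA0 : ∀ τ, 0 ≤ A τ := fun τ => norm_nonneg _
  have hlev := isAntichainNodes_of_subset_level (subset_refl (level N))
  have hA2 : ∑ τ ∈ level N, A τ ^ 2 ≤ 2 := by
    refine (sum_norm_restrict_cone_sq_le hlev v₁).trans ?_
    have : ‖v₁‖ ^ 2 ≤ 1 := pow_le_one₀ (norm_nonneg _) hv₁n
    linarith
  have hA1 : 0 ≤ ∑ τ ∈ level N, A τ := sum_nonneg fun τ _ => hA0 τ
  set δ := 1 / (8 * (∑ τ ∈ level N, A τ + 1)) with hδ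
  have hδ0 : 0 < δ := by positivity
  choose σ hσ hσu using fun τ => exists_sign u τ (2 * α * A τ)
  have hcorr : ∀ τ, ∃ v' : FinSupp, τ ∈ level N → (∀ s, v'.coeff s ≠ 0 → τ <+: s) ∧
      ‖v'‖ ≤ 4 * A τ ∧ y (restrict (cone τ) v₁) - 2 * A τ * δ ≤ y v' ∧
      (∀ β ∈ 𝓑, pathSum (branch β) v' = 0) ∧
      ∀ P, IsPath P → τ ∈ P → -(2 * A τ) ≤ σ τ * pathSum P v' ∧ σ τ * pathSum P v' ≤ 0 := by
    intro τ
    by_cases hτ : τ ∈ level N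
    · have hl := mem_level.1 hτ
      obtain ⟨v', hv'⟩ := exists_correction y (v := restrict (cone τ) v₁)
        (fun s hs => mem_of_coeff_restrict_ne hs) (hyN τ hl.le) (hσ τ) 𝓑 (h𝓑 τ hl.ge) hδ0.le
        fun β hβ => hy β hβ δ hδ0
      exact ⟨v', fun _ => hv'⟩
    · exact ⟨0, fun h => absurd h hτ⟩
  choose w hw using hcorr
  set v := ∑ τ ∈ level N, w τ with hv
  have hvs : ∀ t, v.coeff t ≠ 0 → N ≤ t.length := by
    intro t ht
    rw [hv, coeff_sum] at ht
    obtain ⟨τ, hτ, hne⟩ := exists_ne_zero_of_sum_ne_zero ht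
    exact (mem_level.1 hτ).ge.trans ((hw τ hτ).1 t hne).length_le
  have hvn : ‖v‖ ^ 2 ≤ 32 := by
    refine (norm_sum_cone_sq_le hlev w fun τ hτ => (hw τ hτ).1).trans ?_
    calc ∑ τ ∈ level N, ‖w τ‖ ^ 2 ≤ ∑ τ ∈ level N, 16 * A τ ^ 2 := by
          refine sum_le_sum fun τ hτ => ?_
          have h := pow_le_pow_left₀ (norm_nonneg _) (hw τ hτ).2.1 2
          linarith [mul_pow 4 (A τ) 2]
      _ ≤ 32 := by rw [← mul_sum]; linarith
  refine ⟨v, hvs, fun β hβ => ?_, ?_, ?_, ?_⟩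
  · rw [hv, map_sum]
    exact sum_eq_zero fun τ hτ => (hw τ hτ).2.2.2.1 β hβ
  · nlinarith [norm_nonneg v]
  · have h1 : ∑ τ ∈ level N, (y (restrict (cone τ) v₁) - 2 * A τ * δ) ≤ y v := by
      rw [hv, map_sum]
      exact sum_le_sum fun τ hτ => (hw τ hτ).2.2.1
    rw [sum_sub_distrib, ← map_sum, sum_restrict_cone hv₁s, ← sum_mul, ← mul_sum] at h1
    have h2 : 2 * (∑ τ ∈ level N, A τ) * δ ≤ 1 / 4 := by
      rw [hδ, mul_one_div, div_le_div_iff₀ (by positivity) (by norm_num)]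
      linarith
    linarith
  · have hpath : ∀ τ ∈ level N, ∀ P, IsPath P → τ ∈ P → pathSum P v = pathSum P (w τ) := by
      intro τ hτ P hP hτP
      rw [hv, map_sum, sum_eq_single_of_mem τ hτ]
      intro τ' hτ' hne
      refine pathSum_eq_zero fun s hs hsP => hne ?_
      have h1 : τ' <+: s := (hw τ' hτ').1 s hs
      have hl := mem_level.1 hτ
      have hl' := mem_level.1 hτ'
      have h2 : τ <+: s := hP.prefix_of_length_le hτP hsP (by have := h1.length_le; omega)
      exact eq_of_mem_cone (hl'.trans hl.symm) h1 h2
    have h := norm_add_sq_le hu (v := α • v) (fun t ht => hvs t (by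
        rw [FinSupp.coeff_smul] at ht; exact right_ne_zero_of_mul ht)) σ
      (fun τ => 2 * α * A τ) (fun τ _ => hσ τ) (fun τ _ => hσu τ) (fun τ hτ P hP hτP => by
        obtain ⟨h1, h2⟩ := (hw τ hτ).2.2.2.2 P hP hτP
        have h3 : σ τ * pathSum P (α • v) = α * (σ τ * pathSum P (w τ)) := by
          rw [map_smul, hpath τ hτ P hP hτP, smul_eq_mul]; ring
        rw [h3]
        constructor <;> nlinarith)
    have h1 : ‖α • v‖ ^ 2 ≤ 32 * α ^ 2 := by
      rw [norm_smul, mul_pow, Real.norm_eq_abs, sq_abs]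
      nlinarith [sq_nonneg α]
    have h2 : ∑ τ ∈ level N, (2 * α * A τ) ^ 2 ≤ 8 * α ^ 2 := by
      simp only [mul_pow, ← mul_sum]
      nlinarith [sq_nonneg α]
    linarith

/-! ### The dual of the completion -/

/-- Finitely many functionals vanish simultaneously on some closed finite-codimensional subspace. -/
theorem exists_finiteCodim_forall_eq_zero {X : Type*} [NormedAddCommGroup X] [NormedSpace ℝ X]
    (s : Finset (StrongDual ℝ X)) :
    ∃ Y ∈ finiteCodimSubspaces X, ∀ y ∈ Y, ∀ f ∈ s, f y = 0 := by
  refine ⟨_, ⟨#s, fun i => s.equivFin.symm i, rfl⟩, fun y hy f hf => ?_⟩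
  rw [Submodule.mem_iInf] at hy
  simpa using hy (s.equivFin ⟨f, hf⟩)

open Filter in
/-- A bounded sequence has a weak-star cluster point in the bidual; a functional annihilated by that
cluster point is often small along the sequence. -/
theorem exists_bidual_cluster {X : Type*} [NormedAddCommGroup X] [NormedSpace ℝ X] (x : ℕ → X)
    (hx : ∀ n, ‖x n‖ ≤ 1) :
    ∃ φ : StrongDual ℝ (StrongDual ℝ X), ∀ y, φ y = 0 → ∀ δ > 0, ∀ M, ∃ n ≥ M, |y (x n)| ≤ δ := by
  let g : ℕ → WeakDual ℝ (StrongDual ℝ X) := fun n =>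
    StrongDual.toWeakDual (NormedSpace.inclusionInDoubleDual ℝ X (x n))
  obtain ⟨φ, -, hφ⟩ := (WeakDual.isCompact_closedBall (𝕜 := ℝ) (E := StrongDual ℝ X) 0
    1).exists_mapClusterPt (f := atTop) (u := g) (by
      rw [le_principal_iff]
      refine mem_map.2 (Eventually.of_forall fun n => ?_)
      change NormedSpace.inclusionInDoubleDual ℝ X (x n) ∈ Metric.closedBall 0 1
      refine (mem_closedBall_zero_iff (E := StrongDual ℝ (StrongDual ℝ X))).2 ?_
      exact (NormedSpace.double_dual_bound ℝ X (x n)).trans (hx n))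
  refine ⟨WeakDual.toStrongDual φ, fun y hy δ hδ M => ?_⟩
  have h1 := hφ.continuousAt_comp (WeakDual.eval_continuous y).continuousAt
  have hy' : φ y = 0 := hy
  rw [hy'] at h1
  obtain ⟨n, hn, hnM⟩ := ((h1.frequently (Metric.closedBall_mem_nhds 0 hδ)).and_eventually
    (eventually_ge_atTop M)).exists
  refine ⟨n, hnM, ?_⟩
  rw [dist_zero_right] at hn
  exact hn

/-- The restriction of a functional on the James tree space to the finitely supported functions. -/
noncomputable def restrictDual : StrongDual ℝ JamesTreeSpace →ₗ[ℝ] StrongDual ℝ FinSupp where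
  toFun x := x.comp UniformSpace.Completion.toComplL
  map_add' _ _ := rfl
  map_smul' _ _ := rfl

theorem restrictDual_apply (x : StrongDual ℝ JamesTreeSpace) (w : FinSupp) :
    restrictDual x w = x (w : JamesTreeSpace) := rfl

theorem norm_restrictDual (x : StrongDual ℝ JamesTreeSpace) : ‖restrictDual x‖ = ‖x‖ := by
  refine le_antisymm ?_ ?_
  · refine ContinuousLinearMap.opNorm_le_bound _ (norm_nonneg _) fun w => ?_
    rw [restrictDual_apply, ← UniformSpace.Completion.norm_coe w]
    exact x.le_opNorm _
  · refine ContinuousLinearMap.opNorm_le_bound _ (norm_nonneg _) fun z => ?_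
    induction z using UniformSpace.Completion.induction_on with
    | hp => exact isClosed_le (by fun_prop) (by fun_prop)
    | ih w =>
      rw [← restrictDual_apply, UniformSpace.Completion.norm_coe]
      exact (restrictDual x).le_opNorm w

theorem restrictDual_injective : Function.Injective restrictDual := by
  intro x x' h
  rw [← sub_eq_zero, ← norm_eq_zero, ← norm_restrictDual, map_sub, h, sub_self, norm_zero]

theorem exists_restrictDual_eq (f : StrongDual ℝ FinSupp) :
    ∃ x : StrongDual ℝ JamesTreeSpace, restrictDual x = f := by
  refine ⟨f.extend UniformSpace.Completion.toComplL, ContinuousLinearMap.ext fun w => ?_⟩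
  exact f.extend_eq UniformSpace.Completion.denseRange_coe
    (UniformSpace.Completion.isUniformInducing_coe _) w

/-- The modulus of asymptotic convexity of the dual of the James tree space is at least
`ε² / 20000`. -/
theorem exists_subspace_forall_norm_le (x : StrongDual ℝ JamesTreeSpace) (hx : ‖x‖ = 1) {ε : ℝ}
    (hε : 0 < ε) (hε1 : ε ≤ 1) :
    ∃ Y ∈ finiteCodimSubspaces (StrongDual ℝ JamesTreeSpace), ∀ y ∈ Y, ‖y‖ = 1 →
      1 + ε ^ 2 / 20000 ≤ ‖x + ε • y‖ := by
  classical
  set g := restrictDual x with hg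
  have hg1 : ‖g‖ = 1 := (norm_restrictDual x).trans hx
  set η := ε ^ 2 / 20000 with hη
  have hη0 : 0 < η := by positivity
  obtain ⟨u, hu1, hgu⟩ : ∃ u : FinSupp, ‖u‖ ≤ 1 ∧ 1 - η ≤ g u := by
    obtain ⟨w, hw, hgw⟩ := g.exists_lt_apply_of_lt_opNorm (r := 1 - η) (by rw [hg1]; linarith)
    rw [Real.norm_eq_abs] at hgw
    rcases abs_choice (g w) with h | h
    · exact ⟨w, hw.le, by rw [← h]; exact hgw.le⟩
    · exact ⟨-w, by rw [norm_neg]; exact hw.le, by rw [map_neg, ← h]; exact hgw.le⟩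
  obtain ⟨𝓑, N₁, h𝓑⟩ := exists_branches_bound g hη0
  obtain ⟨N₂, hN₂⟩ := exists_level_separating 𝓑
  obtain ⟨N₃, hN₃⟩ := exists_length_lt u
  set N := max N₁ (max N₂ N₃) with hN
  have hNN₁ : N₁ ≤ N := le_max_left _ _
  have hNN₂ : N₂ ≤ N := (le_max_left _ _).trans (le_max_right _ _)
  have hNN₃ : N₃ ≤ N := (le_max_right _ _).trans (le_max_right _ _)
  have hu : ∀ t, u.coeff t ≠ 0 → t.length < N := fun t ht => (hN₃ t ht).trans_le hNN₃
  choose φ hφ using fun β : ℕ → Bool =>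
    exists_bidual_cluster (fun n => (FinSupp.single (node β n) 1 : JamesTreeSpace)) fun n => by
      rw [UniformSpace.Completion.norm_coe]
      simpa using norm_single_le (node β n) 1
  obtain ⟨Y, hY, hYs⟩ := exists_finiteCodim_forall_eq_zero
    (𝓑.image φ ∪ (List.finite_length_le Bool N).toFinset.image fun t =>
      NormedSpace.inclusionInDoubleDual ℝ JamesTreeSpace (FinSupp.single t 1 : FinSupp))
  refine ⟨Y, hY, fun y hy hy1 => ?_⟩
  set h := restrictDual y with hh
  have hh1 : ‖h‖ = 1 := (norm_restrictDual y).trans hy1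
  have hhN : ∀ t : Tree, t.length ≤ N → h (FinSupp.single t 1) = 0 := by
    intro t ht
    have := hYs y hy (NormedSpace.inclusionInDoubleDual ℝ JamesTreeSpace (FinSupp.single t 1 :
      FinSupp)) (mem_union_right _ (mem_image_of_mem _ (by simpa using ht)))
    rwa [NormedSpace.dual_def] at this
  have hh𝓑 : ∀ β ∈ 𝓑, ∀ δ > 0, ∀ M, ∃ n ≥ M, |h (FinSupp.single (node β n) 1)| ≤ δ :=
    fun β hβ => hφ β y (hYs y hy (φ β) (mem_union_left _ (mem_image_of_mem φ hβ)))
  -- With this `α` the gain `ε α / 4` is twice the loss `28 α ^ 2`, so half of it is kept.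
  set α := ε / 224 with hα
  have hα0 : 0 < α := by positivity
  obtain ⟨v, hvN, hvB, hvn, hhv, hsq⟩ := exists_perturbation hu hh1 hhN 𝓑
    (fun τ hτ => hN₂ τ (hNN₂.trans hτ)) hh𝓑 hα0
  have hgv : |g v| ≤ η * 6 := (h𝓑 v (fun t ht => hNN₁.trans (hvN t ht)) hvB).trans (by gcongr)
  have hhu : h u = 0 := apply_eq_zero fun t ht => hhN t (hu t ht).le
  have hnorm : ‖u + α • v‖ ≤ 1 + 28 * α ^ 2 := by
    refine le_of_sq_le_sq (hsq.trans ?_) (by positivity)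
    have : ‖u‖ ^ 2 ≤ 1 := pow_le_one₀ (norm_nonneg _) hu1
    nlinarith [sq_nonneg (α ^ 2)]
  have hval : 1 - η - α * (η * 6) + ε * (α * (1 / 4)) ≤ (g + ε • h) (u + α • v) := by
    have h1 : (g + ε • h) (u + α • v) = g u + α * g v + ε * (h u + α * h v) := by
      simp
    rw [h1, hhu]
    have h2 : α * -(η * 6) ≤ α * g v := by
      have := (abs_le.1 hgv).1
      gcongr
    have h3 : ε * (α * (1 / 4)) ≤ ε * (α * h v) := by gcongr
    linarith
  have hle : (g + ε • h) (u + α • v) ≤ ‖x + ε • y‖ * (1 + 28 * α ^ 2) := by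
    refine (le_abs_self _).trans (((g + ε • h).le_opNorm _).trans ?_)
    rw [show g + ε • h = restrictDual (x + ε • y) by rw [map_add, map_smul], norm_restrictDual]
    gcongr
  by_contra! hlt
  have h4 : ‖x + ε • y‖ * (1 + 28 * α ^ 2) ≤ (1 + η) * (1 + 28 * α ^ 2) := by gcongr
  have h5 : (1 + η) * (1 + 28 * α ^ 2) < 1 - η - α * (η * 6) + ε * (α * (1 / 4)) := by
    rw [hη, hα]
    have h6 : 0 < ε ^ 2 := by positivity
    nlinarith [mul_pos h6 hε, mul_pos h6 h6, mul_le_mul_of_nonneg_left hε1 h6.le]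
  linarith

theorem isAsymptoticallyUniformlyConvex_dual :
    IsAsymptoticallyUniformlyConvex (StrongDual ℝ JamesTreeSpace) := by
  intro ε hε hε1
  have h0 : (0 : EReal) < ((ε ^ 2 / 20000 : ℝ) : EReal) := by
    exact_mod_cast (by positivity : 0 < ε ^ 2 / 20000)
  refine h0.trans_le (le_iInf₂ fun x hx => ?_)
  obtain ⟨Y, hY, h⟩ := exists_subspace_forall_norm_le x hx hε hε1
  refine le_trans (le_iInf₂ fun y hy => ?_) (le_iSup₂ (f := fun Y _ =>
    ⨅ y ∈ {y : StrongDual ℝ JamesTreeSpace | y ∈ Y ∧ ‖y‖ = 1},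
      ((‖x + ε • y‖ - 1 : ℝ) : EReal)) Y hY)
  exact EReal.coe_le_coe_iff.2 (by linarith [h y hy.1 hy.2])

/-! ### A bounded dyadic tree in the dual -/

open Classical in
/-- The weights of the average of the branch sums over all branches through `t`. -/
noncomputable def branchAverage (t s : Tree) : ℝ :=
  if s <+: t then 1 else if t <+: s then (1 / 2) ^ (s.length - t.length) else 0

/-- Half of the branches through `t` pass through either successor of `t`. -/
theorem branchAverage_eq (t s : Tree) : branchAverage t s =
    (branchAverage (t ++ [false]) s + branchAverage (t ++ [true]) s) / 2 := by
  classical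
  by_cases hst : s <+: t
  · have h : ∀ b, s <+: t ++ [b] := fun b => hst.trans (List.prefix_append t [b])
    simp [branchAverage, hst, h]
  by_cases hts : t <+: s
  · obtain ⟨r, rfl⟩ := hts
    rcases r with _ | ⟨b, r⟩
    · simp at hst
    · have h : ∀ c, branchAverage (t ++ [c]) (t ++ b :: r) =
          if c = b then (1 / 2) ^ r.length else 0 := by
        intro c
        rcases r with _ | ⟨d, r⟩
        · by_cases hc : c = b
          · simp [branchAverage, hc]
          · simp [branchAverage, hc, Ne.symm hc]
        · have hl : t.length + (r.length + 1 + 1) - (t.length + 1) = r.length + 1 := by omega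
          simp [branchAverage, hl]
      have h0 : branchAverage t (t ++ b :: r) = (1 / 2) ^ (r.length + 1) := by
        rw [branchAverage, if_neg hst, if_pos (List.prefix_append t _)]
        congr 1
        simp
      rw [h, h, h0, pow_succ]
      cases b <;> simp <;> ring
  · have h : ∀ b, ¬ s <+: t ++ [b] := by
      intro b hb
      rcases List.prefix_concat_iff.1 hb with rfl | hb
      · exact hts (List.prefix_append t [b])
      · exact hst hb
    have h' : ∀ b, ¬ t ++ [b] <+: s := fun b hb => hts ((List.prefix_append t [b]).trans hb)
    simp [branchAverage, hst, hts, h, h']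

theorem abs_weightedSum_branchAverage_le (t : Tree) (w : FinSupp) :
    |weightedSum (branchAverage t) w| ≤ ‖w‖ := by
  obtain ⟨M, hM⟩ := exists_length_lt w
  induction hk : M - t.length generalizing t with
  | zero =>
    have h : weightedSum (branchAverage t) w = pathSum {s | s <+: t} w := by
      classical
      refine weightedSum_congr fun s hs => ?_
      have hs' := hM s hs
      by_cases hst : s <+: t
      · simp [branchAverage, hst]
      · have hts : ¬ t <+: s := fun h => by have := h.length_le; omega
        simp [branchAverage, hst, hts]
    rw [h]
    refine abs_pathSum_le ⟨fun a b ha hb => List.prefix_or_prefix_of_prefix ha hb, ?_⟩ w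
    exact fun a b c _ hc _ h => h.trans hc
  | succ k ih =>
    have h0 := abs_le.1 (ih (t ++ [false]) (by simp; omega))
    have h1 := abs_le.1 (ih (t ++ [true]) (by simp; omega))
    have h : weightedSum (branchAverage t) w =
        (weightedSum (branchAverage (t ++ [false])) w +
          weightedSum (branchAverage (t ++ [true])) w) / 2 := by
      simp only [weightedSum_apply, ← sum_add_distrib, sum_div]
      refine sum_congr rfl fun s _ => ?_
      rw [branchAverage_eq]
      ring
    rw [h, abs_le]
    constructor <;> linarith

/-- The averages of the branch sums form a bounded dyadic tree in the dual. -/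
theorem exists_dyadic_tree : ∃ X : Tree → StrongDual ℝ JamesTreeSpace, (∀ t, ‖X t‖ ≤ 1) ∧
    (∀ t, X (t ++ [false]) + X (t ++ [true]) = (2 : ℝ) • X t) ∧
    ∀ t, 1 ≤ ‖X (t ++ [true]) - X (t ++ [false])‖ := by
  classical
  let f : Tree → StrongDual ℝ FinSupp := fun t => (weightedSum (branchAverage t)).mkContinuous 1
    fun w => by rw [one_mul]; exact abs_weightedSum_branchAverage_le t w
  choose X hX using fun t => exists_restrictDual_eq (f t)
  have hf : ∀ t w, f t w = weightedSum (branchAverage t) w := fun _ _ => rfl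
  refine ⟨X, fun t => ?_, fun t => restrictDual_injective ?_, fun t => ?_⟩
  · rw [← norm_restrictDual, hX]
    exact LinearMap.mkContinuous_norm_le _ zero_le_one _
  · rw [map_add, map_smul, hX, hX, hX]
    refine ContinuousLinearMap.ext fun w => ?_
    change f _ w + f _ w = 2 * f t w
    simp only [hf, weightedSum_apply, ← sum_add_distrib, mul_sum]
    refine sum_congr rfl fun s _ => ?_
    rw [branchAverage_eq t]
    ring
  · rw [← norm_restrictDual, map_sub, hX, hX]
    set e := FinSupp.single (t ++ [true]) 1
    have he : ‖e‖ ≤ 1 := by simpa using norm_single_le (t ++ [true]) 1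
    have h1 : (f (t ++ [true]) - f (t ++ [false])) e = 1 := by
      change f _ e - f _ e = 1
      rw [hf, hf, weightedSum_single, weightedSum_single]
      have h2 : ¬ (t ++ [true]) <+: (t ++ [false]) := by simp
      have h3 : ¬ (t ++ [false]) <+: (t ++ [true]) := by simp
      simp [branchAverage, h2, h3]
    have h2 := ContinuousLinearMap.le_opNorm (f (t ++ [true]) - f (t ++ [false])) e
    rw [h1, norm_one] at h2
    exact h2.trans (mul_le_of_le_one_right (norm_nonneg _) he)

theorem not_hasRadonNikodymProperty_dual :
    ¬ HasRadonNikodymProperty (StrongDual ℝ JamesTreeSpace) := by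
  intro hRN
  obtain ⟨X, hX1, hX2, hX3⟩ := exists_dyadic_tree
  have hb : Bornology.IsBounded (Set.range X) := by
    refine isBounded_iff_forall_norm_le.2 ⟨1, ?_⟩
    rintro _ ⟨t, rfl⟩
    exact hX1 t
  obtain ⟨f, a, ⟨_, ⟨t, rfl⟩, hta⟩, hdiam⟩ :=
    hRN (Set.range X) (Set.range_nonempty X) hb (1 / 2) (by norm_num)
  have hsum : f (X (t ++ [false])) + f (X (t ++ [true])) = 2 * f (X t) := by
    rw [← map_add, hX2, map_smul, smul_eq_mul]
  -- One of the two successors of `X t` lies in the slice, and it is far from `X t`.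
  have key : ∀ b c, X (t ++ [b]) + X (t ++ [c]) = (2 : ℝ) • X t →
      1 ≤ ‖X (t ++ [b]) - X (t ++ [c])‖ → a < f (X (t ++ [b])) → False := by
    intro b c h2 h3 hslice
    have h := Metric.dist_le_diam_of_mem (s := {x ∈ Set.range X | a < f x})
      (hb.subset fun _ h => h.1) ⟨⟨_, rfl⟩, hslice⟩ ⟨⟨t, rfl⟩, hta⟩
    have h4 : X (t ++ [b]) - X (t ++ [c]) = (2 : ℝ) • (X (t ++ [b]) - X t) := by
      rw [smul_sub, ← h2, two_smul]; abel
    rw [h4, norm_smul, Real.norm_eq_abs, abs_two] at h3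
    rw [dist_eq_norm] at h
    linarith
  rcases lt_or_ge a (f (X (t ++ [false]))) with h | h
  · exact key false true (hX2 t) (by rw [norm_sub_rev]; exact hX3 t) h
  · exact key true false (by rw [add_comm]; exact hX2 t) (hX3 t) (by linarith)


end JamesTree

theorem theorem3 :
    IsAsymptoticallyUniformlyConvex (StrongDual ℝ JamesTreeSpace) ∧
      ¬ HasRadonNikodymProperty (StrongDual ℝ JamesTreeSpace) :=
  ⟨JamesTree.isAsymptoticallyUniformlyConvex_dual, JamesTree.not_hasRadonNikodymProperty_dual⟩
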